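/- Let $X$ be the vector space of finite payoff streams: each $x\in X$ is given by a payoff function $m_x:[0,\infty)\to\mathbb{R}$ with finite support $T_x=\{t: m_x(t)\neq 0\}$. For $t\in[0,\infty]$ let $M_x(t)=\sum_{s\le t}m_x(s)$, and write $x\ge y$ if $M_x(t)\ge M_y(t)$ for all $t\in[0,\infty]$. Let $X$ carry any topology that is at least as fine as the topology of uniform convergence of the functions $M_x$ and for which, for every finite set $T$ of dates, the stream paying $c_t$ at each $t\in T$ (and nothing else) depends continuously on $c\in\mathbb{R}^T$; for example, the topology of the norm $\sum_t|m_x(t)|$. A binary choice rule is a map $\rho:\{(x,y)\in X^2:x\ne y\}\to[0,1]$ with $\rho(x,y)=1-\rho(y,x)$. In the axioms, all pairs at which $\rho$ is evaluated are assumed to consist of distinct streams. * T1 (Continuity): $\rho$ is continuous on its domain. * T2 (Linearity): $\rho(x,y)=\rho(\lambda x+(1-\lambda)z,\lambda y+(1-\lambda)z)$ for all $x,y,z$ and $\lambda\in(0,1)$. * T3 (Moderate Transitivity): if $\rho(x,y)\ge\frac12$ and $\rho(y,z)\ge\frac12$, then $\rho(x,z)>\min\{\rho(x,y),\rho(y,z)\}$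 or $\rho(x,z)=\rho(x,y)=\rho(y,z)$. * T4 (Dominance): if $x\ge y$, then $\rho(x,y)\ge\rho(w,z)$ for all $w,z$, strictly if $w\not\ge z$. * T5 (Simplification): if $\rho(x,y)\ge\frac12$ and $x'$ has support in $T_x\cup T_y$, $M_{x'}(t^*)=M_y(t^*)$ for some $t^*\in T_x\cup T_y$, $M_{x'}(t)\ne M_x(t)$ for at most one $t\in (T_x\cup T_y)\setminus\{t^*\}$, and $\rho(x',x)=\frac12$, then $\rho(x',y)\ge\rho(x,y)$. * Stationarity: if $\rho(x,y)>\frac12$, $k>0$, and $x',y'$ satisfy $m_{x'}(t)=m_x(t-k)$, $m_{y'}(t)=m_y(t-k)$ for $t\ge k$ and $m_{x'}(t)=m_{y'}(t)=0$ for $t<k$, then $\rho(x',y')\ge\frac12$. A discount function is a strictly decreasing $d:[0,\infty]\to[0,\infty)$ with $d(\infty)=0$. Put $DU(x)=\sum_t d(t)m_x(t)$ and $$d_{CPF}(x,y)=\sum_{k=0}^{n-1}|M_x(t_k)-M_y(t_k)|\,(d(t_k)-d(t_{k+1})),$$ where $t_0<\dots<t_n$ enumerates $T_x\cup T_y\cup\{0,\infty\}$.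 A generalized CPF-complexity representation of $\rho$ is a pair $(G,d)$ of a continuous, strictly increasing $G:[-1,1]\to\mathbb{R}$ and a discount function $d$ with $$\rho(x,y)=G\left(\frac{DU(x)-DU(y)}{d_{CPF}(x,y)}\right)\quad\text{for all }x\ne y.$$ A CPF-complexity representation of $\rho$ is a pair $(G,\delta)$ with $G$ as above and $\delta\in(0,1)$ such that, for all $x\neq y$, the same formula holds with $PV(x)=\sum_t\delta^t m_x(t)$ in place of $DU(x)$ and $\ln(1/\delta)\int_0^\infty|M_x(t)-M_y(t)|\,\delta^t\,dt$ in place of $d_{CPF}(x,y)$. **Theorem.** Let $\rho$ be a binary choice rule on $X$. 1. $\rho$ satisfies T1–T5 if and only if it has a generalized CPF-complexity representation. 2. If $(G,d)$ and $(G',d')$ are generalized CPF-complexity representations of $\rho$, then $G'=G$ and there is $C>0$ with $d'=Cd$. 3. $\rho$ satisfies T1–T5 and Stationarity if and only if it has a CPF-complexity representation $(G,\delta)$. 4. If $(G,d)$ is a generalized CPF-complexity representation of $\rho$, then $\rho$ satisfies Stationarity if and only if there is $\delta\in(0,1)$ with $d(t)=d(0)\,\delta^t$ for all $t\in[0,\infty)$.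 -/

import Mathlib

open scoped NNReal ENNReal

noncomputable section

/-- A finite payoff stream, given by its payoff function `m_x : [0, ∞) → ℝ`, which is nonzero at
finitely many dates.  `x t` is the amount paid at date `t` and `x.support` is the support `T_x`.
The vector space operations are the pointwise ones. -/
abbrev PayoffStream : Type := ℝ≥0 →₀ ℝ

/-- The cumulative payoff function `M_x(t) = ∑_{s ≤ t} m_x(s)`, for `t ∈ [0, ∞]`. -/
def cumulativePayoff (x : PayoffStream) (t : ℝ≥0∞) : ℝ :=
  x.sum fun s a => if (s : ℝ≥0∞) ≤ t then a else 0

/-- Temporal dominance `x ≥ y`: at every date `x` has paid out at least as much as `y`. -/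
def TemporallyDominates (x y : PayoffStream) : Prop :=
  ∀ t : ℝ≥0∞, cumulativePayoff y t ≤ cumulativePayoff x t

/-- `ρ` is a binary choice rule: it has values in `[0, 1]` and `ρ(x, y) = 1 - ρ(y, x)`.  Its domain
is the set of pairs of distinct options; the values `ρ x x` are never referred to. -/
def IsBinaryChoiceRule (ρ : PayoffStream → PayoffStream → ℝ) : Prop :=
  ∀ x y, x ≠ y → ρ x y ∈ Set.Icc (0 : ℝ) 1 ∧ ρ x y = 1 - ρ y x

/-- A topology on payoff streams is admissible if it is at least as fine as uniform convergence of
cumulative payoff functions, and if, for each finite set of dates, a stream that pays only at these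
dates depends continuously on the amounts paid (with the usual topology of `ℝ^T`).  For example,
the topology of the norm `∑ t, |m_x(t)|`, that of the norm `sup_t |M_x(t)|`, and the finest locally
convex topology are admissible. -/
structure IsAdmissibleTopology (τ : TopologicalSpace PayoffStream) : Prop where
  uniform_nhds : ∀ (x : PayoffStream) (ε : ℝ), 0 < ε →
    {y : PayoffStream | ∀ t, |cumulativePayoff y t - cumulativePayoff x t| < ε} ∈ nhds x
  continuous_amounts : ∀ T : Finset ℝ≥0,
    Continuous fun c : T → ℝ => ∑ t : T, Finsupp.single (t : ℝ≥0) (c t)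

/-! ### The axioms -/

/-- T1: `ρ` is continuous on its domain, the set of pairs of distinct streams. -/
def Continuity [TopologicalSpace PayoffStream] (ρ : PayoffStream → PayoffStream → ℝ) : Prop :=
  ContinuousOn (fun p : PayoffStream × PayoffStream => ρ p.1 p.2) {p | p.1 ≠ p.2}

/-- T2. -/
def Linearity (ρ : PayoffStream → PayoffStream → ℝ) : Prop :=
  ∀ x y z : PayoffStream, x ≠ y → ∀ l ∈ Set.Ioo (0 : ℝ) 1,
    ρ x y = ρ (l • x + (1 - l) • z) (l • y + (1 - l) • z)

/-- T3. -/
def ModerateTransitivity (ρ : PayoffStream → PayoffStream → ℝ) : Prop :=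
  ∀ x y z : PayoffStream, x ≠ y → y ≠ z → x ≠ z → 1 / 2 ≤ ρ x y → 1 / 2 ≤ ρ y z →
    min (ρ x y) (ρ y z) < ρ x z ∨ (ρ x z = ρ x y ∧ ρ x y = ρ y z)

/-- T4. -/
def Dominance (ρ : PayoffStream → PayoffStream → ℝ) : Prop :=
  ∀ x y : PayoffStream, x ≠ y → TemporallyDominates x y → ∀ w z : PayoffStream, w ≠ z →
    ρ w z ≤ ρ x y ∧ (¬ TemporallyDominates w z → ρ w z < ρ x y)

/-- T5.  The pairs at which `ρ` is evaluated consist of distinct streams. -/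
def Simplification (ρ : PayoffStream → PayoffStream → ℝ) : Prop :=
  ∀ x y : PayoffStream, x ≠ y → 1 / 2 ≤ ρ x y →
    ∀ x' : PayoffStream, x'.support ⊆ x.support ∪ y.support →
    (∃ t₀ ∈ x.support ∪ y.support, cumulativePayoff x' t₀ = cumulativePayoff y t₀ ∧
      {t : ℝ≥0 | t ∈ (x.support ∪ y.support) \ {t₀} ∧
        cumulativePayoff x' t ≠ cumulativePayoff x t}.Subsingleton) →
    x' ≠ x → ρ x' x = 1 / 2 → x' ≠ y → ρ x y ≤ ρ x' y

/-- Stationarity: delaying both streams by `k > 0` never strictly reverses a strict preference. -/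
def Stationarity (ρ : PayoffStream → PayoffStream → ℝ) : Prop :=
  ∀ x y : PayoffStream, x ≠ y → 1 / 2 < ρ x y → ∀ (x' y' : PayoffStream) (k : ℝ≥0), 0 < k →
    (∀ t, k ≤ t → x' t = x (t - k) ∧ y' t = y (t - k)) →
    (∀ t, t < k → x' t = 0 ∧ y' t = 0) →
    1 / 2 ≤ ρ x' y'

/-- The conjunction of T1 -- T5. -/
structure SatisfiesT1toT5 [TopologicalSpace PayoffStream]
    (ρ : PayoffStream → PayoffStream → ℝ) : Prop where
  continuity : Continuity ρ
  linearity : Linearity ρ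
  moderateTransitivity : ModerateTransitivity ρ
  dominance : Dominance ρ
  simplification : Simplification ρ

/-! ### The representations -/

/-- A discount function `d : [0, ∞] → [0, ∞)`: strictly decreasing with `d(∞) = 0` (so that it is
automatically nonnegative, and positive at finite dates). -/
structure IsDiscountFunction (d : ℝ≥0∞ → ℝ) : Prop where
  strictAnti : StrictAnti d
  top_eq_zero : d ⊤ = 0

/-- Discounted utility `DU(x) = ∑_t d(t) m_x(t)`. -/
def discountedUtility (d : ℝ≥0∞ → ℝ) (x : PayoffStream) : ℝ :=
  x.sum fun t a => d t * a

/-- The joint support `T_{xy} = T_x ∪ T_y ∪ {0, ∞}`. -/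
def jointSupport (x y : PayoffStream) : Finset ℝ≥0∞ :=
  (x.support ∪ y.support).image (fun t : ℝ≥0 => (t : ℝ≥0∞)) ∪ {0, ⊤}

/-- The element of `T` that follows `t`, that is, the least one above `t` (and `∞` if there is
none). -/
def nextDate (T : Finset ℝ≥0∞) (t : ℝ≥0∞) : ℝ≥0∞ :=
  (T.filter fun s => t < s).inf id

/-- The generalized CPF distance `∑_{k < n} |M_x(t_k) - M_y(t_k)| (d(t_k) - d(t_{k+1}))`, where
`t_0 < ⋯ < t_n = ∞` enumerates the joint support: the sum runs over its elements other than the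
last one, `∞`, and each `t_k` is paired with the element `t_{k+1}` that follows it. -/
def generalizedCPFDist (d : ℝ≥0∞ → ℝ) (x y : PayoffStream) : ℝ :=
  ∑ t ∈ (jointSupport x y).erase ⊤,
    |cumulativePayoff x t - cumulativePayoff y t| * (d t - d (nextDate (jointSupport x y) t))

/-- `(G, d)` is a generalized CPF-complexity representation of `ρ`.  The ratio lies in `[-1, 1]`,
which is the domain of `G`; the values of `G` elsewhere are irrelevant. -/
structure IsGeneralizedCPFRepresentation (ρ : PayoffStream → PayoffStream → ℝ)
    (G : ℝ → ℝ) (d : ℝ≥0∞ → ℝ) : Prop where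
  discount : IsDiscountFunction d
  continuousOn : ContinuousOn G (Set.Icc (-1) 1)
  strictMonoOn : StrictMonoOn G (Set.Icc (-1) 1)
  represents : ∀ x y : PayoffStream, x ≠ y →
    ρ x y = G ((discountedUtility d x - discountedUtility d y) / generalizedCPFDist d x y)

/-- Present value `PV(x) = ∑_t δ^t m_x(t)`. -/
def presentValue (δ : ℝ) (x : PayoffStream) : ℝ :=
  x.sum fun t a => δ ^ (t : ℝ) * a

/-- The CPF distance `ln(1/δ) ∫_0^∞ |M_x(t) - M_y(t)| δ^t dt`. -/
def cpfDist (δ : ℝ) (x y : PayoffStream) : ℝ :=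
  Real.log (1 / δ) * ∫ t in Set.Ioi (0 : ℝ),
    |cumulativePayoff x (ENNReal.ofReal t) - cumulativePayoff y (ENNReal.ofReal t)| * δ ^ t

/-- `(G, δ)` is a CPF-complexity representation of `ρ`, with exponential discounting. -/
structure IsCPFRepresentation (ρ : PayoffStream → PayoffStream → ℝ)
    (G : ℝ → ℝ) (δ : ℝ) : Prop where
  discount_mem : δ ∈ Set.Ioo (0 : ℝ) 1
  continuousOn : ContinuousOn G (Set.Icc (-1) 1)
  strictMonoOn : StrictMonoOn G (Set.Icc (-1) 1)
  represents : ∀ x y : PayoffStream, x ≠ y →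
    ρ x y = G ((presentValue δ x - presentValue δ y) / cpfDist δ x y)

end

open scoped NNReal ENNReal

noncomputable section

/-! ### Linear functionals on payoff streams -/

/-! Order streams by their cumulative payoffs. They form a vector lattice: `absStream v` has
cumulative payoff |M_v|. Summation by parts gives DU(v) = ∑ M_v(t_k)(d(t_k) - d(t_{k+1})) with
positive weights, so DU is a strictly positive functional and the CPF distance of x and y is the L¹
norm DU(|x - y|). In normalized coordinates a_k = M_v(t_k)(d(t_k) - d(t_{k+1})) on a finite grid of
dates, DU is ∑ a_k and the norm is ∑ |a_k|. A representation says that ρ(x, y) is a strictly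
increasing continuous function of `cpfRatio d (x - y)`, and T1–T5 follow from the properties of an
L¹ norm.

Conversely, T2 makes ρ(x, y) depend only on the ray of x - y. By T3 the streams indifferent to 0
form a subspace, and T1 with T4 yields d(t) such that one unit at t is indifferent to d(t) units at
0; hence ρ(v, 0) ≥ 1/2 exactly when DU(v) ≥ 0 (`half_le_iff_discountedLin`). On a grid, T5 says
that, if DU ≥ 0, moving a whole coordinate onto another never lowers ρ. If the two coordinates have
the same sign, the original vector is a convex combination of the two possible moves, and T3 turns
the inequality into equality (`IsTransferMonotone.eq_of_mul_pos`). Merging same-sign coordinates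
reduces every vector to one positive and one negative entry whose places are immaterial once there
are three dates, so ρ depends only on the ratio; T3 and T4 make this dependence strictly increasing
(`ratio_strictMono`). G is then read off along a line on which the ratio runs through [-1, 1].

Indifferences determine d up to a factor. Stationarity preserves them, which makes d(t)/d(0)
multiplicative and, being decreasing, exponential; the integral formula for the CPF distance is then
the same L¹ norm. -/

/-- The cumulative payoff at a finite date, as a linear functional. -/
def cumulativeLin (t : ℝ≥0) : PayoffStream →ₗ[ℝ] ℝ :=
  Finsupp.linearCombination ℝ fun s : ℝ≥0 => if s ≤ t then (1 : ℝ) else 0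

/-- Discounted utility as a linear functional. -/
def discountedLin (d : ℝ≥0∞ → ℝ) : PayoffStream →ₗ[ℝ] ℝ :=
  Finsupp.linearCombination ℝ fun s : ℝ≥0 => d s

lemma cumulativePayoff_coe (x : PayoffStream) (t : ℝ≥0) :
    cumulativePayoff x t = cumulativeLin t x := by
  simp [cumulativePayoff, cumulativeLin, Finsupp.linearCombination_apply]

lemma discountedUtility_eq (d : ℝ≥0∞ → ℝ) (x : PayoffStream) :
    discountedUtility d x = discountedLin d x := by
  simp [discountedUtility, discountedLin, Finsupp.linearCombination_apply, mul_comm]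

lemma cumulativeLin_apply (t : ℝ≥0) (x : PayoffStream) :
    cumulativeLin t x = ∑ s ∈ x.support, if s ≤ t then x s else 0 := by
  simp [cumulativeLin, Finsupp.linearCombination_apply, Finsupp.sum]

lemma cumulativePayoff_top_of_le (x : PayoffStream) (t : ℝ≥0) (h : ∀ s ∈ x.support, s ≤ t) :
    cumulativePayoff x ⊤ = cumulativeLin t x := by
  rw [← cumulativePayoff_coe]
  unfold cumulativePayoff Finsupp.sum
  refine Finset.sum_congr rfl fun s hs => ?_
  simp [h s hs]

/-- A cumulative payoff is constant from the last payment on, so the date ∞ imposes nothing beyond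
the finite dates. -/
lemma temporallyDominates_iff (x y : PayoffStream) :
    TemporallyDominates x y ↔ ∀ t : ℝ≥0, 0 ≤ cumulativeLin t (x - y) := by
  constructor
  · intro h t
    have := h t
    rw [cumulativePayoff_coe, cumulativePayoff_coe] at this
    rw [map_sub]; linarith
  · intro h t
    induction t using ENNReal.recTopCoe with
    | top =>
      have := h ((x.support ∪ y.support).sup id)
      rw [map_sub] at this
      rw [cumulativePayoff_top_of_le x ((x.support ∪ y.support).sup id),
        cumulativePayoff_top_of_le y ((x.support ∪ y.support).sup id)]
      · linarith
      · exact fun s hs => Finset.le_sup (f := id) (Finset.mem_union_right _ hs)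
      · exact fun s hs => Finset.le_sup (f := id) (Finset.mem_union_left _ hs)
    | coe t =>
      have := h t
      rw [map_sub] at this
      rw [cumulativePayoff_coe, cumulativePayoff_coe]; linarith

/-- At the earliest date of the support the cumulative payoff is the payment itself. -/
lemma eq_zero_of_cumulativeLin (v : PayoffStream) (h : ∀ t ∈ v.support, cumulativeLin t v = 0) :
    v = 0 := by
  by_contra hv
  have hne : v.support.Nonempty := Finsupp.support_nonempty_iff.2 hv
  have hm := v.support.min'_mem hne
  have h1 := h _ hm
  rw [cumulativeLin_apply, Finset.sum_eq_single (v.support.min' hne)] at h1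
  · simp only [le_refl, if_true] at h1
    exact (Finsupp.mem_support_iff.1 hm) h1
  · intro s hs hne'
    rw [if_neg]
    intro hle
    exact hne' (le_antisymm hle (Finset.min'_le _ _ hs))
  · intro h'; exact absurd hm h'

lemma stream_ext (T : Finset ℝ≥0) {v w : PayoffStream} (hv : v.support ⊆ T) (hw : w.support ⊆ T)
    (h : ∀ t ∈ T, cumulativeLin t v = cumulativeLin t w) : v = w := by
  refine sub_eq_zero.1 (eq_zero_of_cumulativeLin _ fun t ht => ?_)
  have : t ∈ T := by
    classical
    exact Finset.union_subset hv hw (Finsupp.support_sub ht)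
  rw [map_sub, h t this, sub_self]

lemma stream_ext' {v w : PayoffStream} (h : ∀ t, cumulativeLin t v = cumulativeLin t w) : v = w := by
  classical
  exact stream_ext (v.support ∪ w.support) Finset.subset_union_left Finset.subset_union_right
    fun t _ => h t

/-! ### Unit payments and grids -/

/-- The stream paying one unit at `t`; nothing is ever paid at `∞`. -/
def unitAt (t : ℝ≥0∞) : PayoffStream :=
  if t = ⊤ then 0 else Finsupp.single t.toNNReal 1

lemma unitAt_coe (t : ℝ≥0) : unitAt t = Finsupp.single t 1 := by simp [unitAt]

lemma cumulativeLin_unitAt (s : ℝ≥0) (t : ℝ≥0∞) :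
    cumulativeLin s (unitAt t) = if t ≤ s then 1 else 0 := by
  induction t using ENNReal.recTopCoe with
  | top => simp [unitAt]
  | coe t => simp [unitAt_coe, cumulativeLin]

lemma discountedLin_unitAt {d : ℝ≥0∞ → ℝ} (hd : d ⊤ = 0) (t : ℝ≥0∞) :
    discountedLin d (unitAt t) = d t := by
  induction t using ENNReal.recTopCoe with
  | top => simp [unitAt, hd]
  | coe t => simp [unitAt_coe, discountedLin]

/-- `n t` is the date that follows `t` in `T ∪ {∞}`, for each `t ∈ T`. -/
structure IsSuccessor (T : Finset ℝ≥0) (n : ℝ≥0 → ℝ≥0∞) : Prop where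
  lt : ∀ t ∈ T, (t : ℝ≥0∞) < n t
  le : ∀ t ∈ T, ∀ s ∈ T, t < s → n t ≤ s
  mem : ∀ t ∈ T, n t = ⊤ ∨ ∃ s ∈ T, n t = (s : ℝ≥0∞)

/-- Whether J contains ∞ is immaterial, since an empty infimum is also ∞. -/
lemma isSuccessor_nextDate {T : Finset ℝ≥0} {J : Finset ℝ≥0∞}
    (h : ∀ s : ℝ≥0, (s : ℝ≥0∞) ∈ J ↔ s ∈ T) :
    IsSuccessor T fun t => nextDate J t where
  lt t _ := by
    simp only [nextDate]
    rw [Finset.lt_inf_iff (ENNReal.coe_lt_top)]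
    intro b hb
    exact (Finset.mem_filter.1 hb).2
  le t _ s hs hts := Finset.inf_le (f := id)
    (Finset.mem_filter.2 ⟨(h s).2 hs, ENNReal.coe_lt_coe.2 hts⟩)
  mem t _ := by
    rcases (J.filter fun s => (t : ℝ≥0∞) < s).eq_empty_or_nonempty with he | hne
    · left; simp [nextDate, he]
    · obtain ⟨b, hb, hb'⟩ := Finset.exists_mem_eq_inf _ hne id
      simp only [nextDate, hb', id]
      by_cases hbt : b = ⊤
      · exact Or.inl hbt
      · right
        lift b to ℝ≥0 using hbt
        exact ⟨b, (h b).1 (Finset.mem_filter.1 hb).1, rfl⟩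

lemma exists_isSuccessor (T : Finset ℝ≥0) : ∃ n, IsSuccessor T n := by
  classical
  exact ⟨_, isSuccessor_nextDate (T := T) (J := T.image fun t => (t : ℝ≥0∞)) (by simp)⟩

section Grid

variable {T : Finset ℝ≥0} {n : ℝ≥0 → ℝ≥0∞}

/-- The stream whose cumulative payoff takes the value `c t` from `t ∈ T` until the next date. -/
def stepStream (T : Finset ℝ≥0) (n : ℝ≥0 → ℝ≥0∞) (c : ℝ≥0 → ℝ) : PayoffStream :=
  ∑ t ∈ T, c t • (unitAt t - unitAt (n t))

lemma cumulativeLin_stepStream (s : ℝ≥0) (c : ℝ≥0 → ℝ) :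
    cumulativeLin s (stepStream T n c) =
      ∑ t ∈ T, c t * ((if t ≤ s then 1 else 0) - if n t ≤ s then 1 else 0) := by
  simp [stepStream, cumulativeLin_unitAt]

/-- Steps that start before `t₀` have ended by `t₀`, and later ones have not started by `s`, so only
the step at `t₀` counts. -/
lemma cumulativeLin_stepStream_floor (hn : IsSuccessor T n) (c : ℝ≥0 → ℝ) {s t₀ : ℝ≥0}
    (h₀ : t₀ ∈ T) (hle : t₀ ≤ s) (hmax : ∀ t ∈ T, t ≤ s → t ≤ t₀) :
    cumulativeLin s (stepStream T n c) = c t₀ := by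
  rw [cumulativeLin_stepStream, Finset.sum_eq_single t₀]
  · rw [if_pos hle, if_neg, sub_zero, mul_one]
    intro h
    rcases hn.mem t₀ h₀ with h1 | ⟨r, hr, h1⟩
    · rw [h1] at h; simp at h
    · have h2 := hn.lt t₀ h₀
      rw [h1] at h h2
      exact absurd (hmax r hr (ENNReal.coe_le_coe.1 h)) (not_le.2 (ENNReal.coe_lt_coe.1 h2))
  · intro t ht hne
    by_cases hts : t ≤ s
    · have h1 : t < t₀ := lt_of_le_of_ne (hmax t ht hts) hne
      have h2 : n t ≤ s := (hn.le t ht t₀ h₀ h1).trans (ENNReal.coe_le_coe.2 hle)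
      rw [if_pos hts, if_pos h2]; simp
    · have h2 : ¬ n t ≤ s := fun h =>
        hts (ENNReal.coe_le_coe.1 ((hn.lt t ht).le.trans h))
      rw [if_neg hts, if_neg h2]; simp
  · intro h; exact absurd h₀ h

lemma cumulativeLin_stepStream_mem (hn : IsSuccessor T n) (c : ℝ≥0 → ℝ) {t : ℝ≥0} (ht : t ∈ T) :
    cumulativeLin t (stepStream T n c) = c t :=
  cumulativeLin_stepStream_floor hn c ht le_rfl fun _ _ h => h

lemma support_stepStream (hn : IsSuccessor T n) (c : ℝ≥0 → ℝ) :
    (stepStream T n c).support ⊆ T := by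
  intro s hs
  by_contra hsT
  apply Finsupp.mem_support_iff.1 hs
  have h1 : ∀ t ∈ T, unitAt t s = 0 := by
    intro t ht
    rw [unitAt_coe, Finsupp.single_apply, if_neg]
    rintro rfl; exact hsT ht
  rw [stepStream, Finsupp.finsetSum_apply]
  refine Finset.sum_eq_zero fun t ht => ?_
  have h2 : unitAt (n t) s = 0 := by
    rcases hn.mem t ht with h | ⟨r, hr, h⟩
    · simp [h, unitAt]
    · rw [h]; exact h1 r hr
  simp [h1 t ht, h2]

lemma stepStream_cumulativeLin (hn : IsSuccessor T n) {v : PayoffStream} (hv : v.support ⊆ T) :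
    stepStream T n (fun t => cumulativeLin t v) = v :=
  stream_ext T (support_stepStream hn _) hv fun _ ht => cumulativeLin_stepStream_mem hn _ ht

/-- Between grid dates both sides keep their value at the last grid date; before the first one M_v
vanishes, whence the condition φ(0) = 0. -/
lemma cumulativeLin_comp_stepStream (hn : IsSuccessor T n) {v : PayoffStream} (hv : v.support ⊆ T)
    (φ : ℝ → ℝ) (hφ : φ 0 = 0) (s : ℝ≥0) :
    cumulativeLin s (stepStream T n fun t => φ (cumulativeLin t v)) = φ (cumulativeLin s v) := by
  by_cases h : ∃ t ∈ T, t ≤ s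
  · classical
    obtain ⟨t, ht, hts⟩ := h
    obtain ⟨t₀, h₀, hmax⟩ := (T.filter (· ≤ s)).exists_maximal ⟨t, by simp [ht, hts]⟩
    rw [Finset.mem_filter] at h₀
    have hmax' : ∀ t ∈ T, t ≤ s → t ≤ t₀ := by
      intro t ht hts
      by_contra hlt
      exact hlt (hmax (Finset.mem_filter.2 ⟨ht, hts⟩) (not_le.1 hlt).le)
    rw [cumulativeLin_stepStream_floor hn _ h₀.1 h₀.2 hmax']
    conv_rhs => rw [← stepStream_cumulativeLin hn hv]
    rw [cumulativeLin_stepStream_floor hn _ h₀.1 h₀.2 hmax']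
  · push Not at h
    have h0 : ∀ c, cumulativeLin s (stepStream T n c) = 0 := by
      intro c
      rw [cumulativeLin_stepStream]
      refine Finset.sum_eq_zero fun t ht => ?_
      have h2 : ¬ n t ≤ s := fun h' =>
        absurd (ENNReal.coe_le_coe.1 ((hn.lt t ht).le.trans h')) (not_le.2 (h t ht))
      rw [if_neg (not_le.2 (h t ht)), if_neg h2]; simp
    rw [h0]
    conv_rhs => rw [← stepStream_cumulativeLin hn hv]
    rw [h0, hφ]

lemma discountedLin_stepStream {d : ℝ≥0∞ → ℝ} (hd : d ⊤ = 0) (c : ℝ≥0 → ℝ) :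
    discountedLin d (stepStream T n c) = ∑ t ∈ T, c t * (d t - d (n t)) := by
  simp [stepStream, discountedLin_unitAt hd]

end Grid

/-! ### The lattice structure and the CPF norm -/

/-- The stream whose cumulative payoff function is the absolute value of that of `v`. -/
def absStream (v : PayoffStream) : PayoffStream :=
  stepStream v.support (exists_isSuccessor v.support).choose fun t => |cumulativeLin t v|

lemma cumulativeLin_absStream (v : PayoffStream) (s : ℝ≥0) :
    cumulativeLin s (absStream v) = |cumulativeLin s v| :=
  cumulativeLin_comp_stepStream (exists_isSuccessor v.support).choose_spec subset_rfl abs abs_zero s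

/-- The modulus may be computed on any grid containing the support, so the CPF norm does not depend
on the grid. -/
lemma stepStream_abs {T : Finset ℝ≥0} {n : ℝ≥0 → ℝ≥0∞} (hn : IsSuccessor T n) {v : PayoffStream}
    (hv : v.support ⊆ T) : stepStream T n (fun t => |cumulativeLin t v|) = absStream v :=
  stream_ext' fun t => by
    rw [cumulativeLin_absStream, cumulativeLin_comp_stepStream hn hv abs abs_zero]

/-- The norm `∑_k |M_v(t_k)| (d(t_k) - d(t_{k+1}))`. -/
def cpfNorm (d : ℝ≥0∞ → ℝ) (v : PayoffStream) : ℝ := discountedLin d (absStream v)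

lemma generalizedCPFDist_eq {d : ℝ≥0∞ → ℝ} (hd : d ⊤ = 0) (x y : PayoffStream) :
    generalizedCPFDist d x y = cpfNorm d (x - y) := by
  classical
  -- This grid may contain dates at which x - y pays nothing; such dates do not affect the sum.
  set T : Finset ℝ≥0 := insert 0 (x.support ∪ y.support) with hT
  have hJ : ∀ s : ℝ≥0, (s : ℝ≥0∞) ∈ jointSupport x y ↔ s ∈ T := by
    intro s
    simp [jointSupport, hT]
  have hn := isSuccessor_nextDate hJ
  have hE : (jointSupport x y).erase ⊤ = T.image fun t : ℝ≥0 => (t : ℝ≥0∞) := by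
    ext s
    induction s using ENNReal.recTopCoe with
    | top => simp
    | coe s => simp [hJ]
  have hv : (x - y).support ⊆ T := Finsupp.support_sub.trans (Finset.subset_insert _ _)
  rw [cpfNorm, ← stepStream_abs hn hv, discountedLin_stepStream hd, generalizedCPFDist, hE,
    Finset.sum_image (fun a _ b _ h => ENNReal.coe_injective h)]
  refine Finset.sum_congr rfl fun t _ => ?_
  rw [cumulativePayoff_coe, cumulativePayoff_coe, map_sub]

section Norm

variable {d : ℝ≥0∞ → ℝ}

lemma IsDiscountFunction.coe_pos (hd : IsDiscountFunction d) (t : ℝ≥0) : 0 < d t := by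
  rw [← hd.top_eq_zero]; exact hd.strictAnti ENNReal.coe_lt_top

/-- Summation by parts writes DU(v) as a combination of cumulative payoffs with weights d(t_k) -
d(t_{k+1}) > 0. -/
lemma discountedLin_nonneg (hd : IsDiscountFunction d) {v : PayoffStream}
    (h : ∀ t, 0 ≤ cumulativeLin t v) : 0 ≤ discountedLin d v := by
  obtain ⟨n, hn⟩ := exists_isSuccessor v.support
  rw [← stepStream_cumulativeLin hn subset_rfl, discountedLin_stepStream hd.top_eq_zero]
  exact Finset.sum_nonneg fun t ht =>
    mul_nonneg (h t) (sub_nonneg.2 (hd.strictAnti (hn.lt t ht)).le)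

lemma discountedLin_pos (hd : IsDiscountFunction d) {v : PayoffStream}
    (h : ∀ t, 0 ≤ cumulativeLin t v) (hv : v ≠ 0) : 0 < discountedLin d v := by
  obtain ⟨n, hn⟩ := exists_isSuccessor v.support
  obtain ⟨t, ht, hne⟩ : ∃ t ∈ v.support, cumulativeLin t v ≠ 0 := by
    by_contra! h'
    exact hv (eq_zero_of_cumulativeLin v h')
  rw [← stepStream_cumulativeLin hn subset_rfl, discountedLin_stepStream hd.top_eq_zero]
  exact Finset.sum_pos' (fun t ht =>
    mul_nonneg (h t) (sub_nonneg.2 (hd.strictAnti (hn.lt t ht)).le))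
    ⟨t, ht, mul_pos ((h t).lt_of_ne' hne) (sub_pos.2 (hd.strictAnti (hn.lt t ht)))⟩

lemma discountedLin_mono (hd : IsDiscountFunction d) {v w : PayoffStream}
    (h : ∀ t, cumulativeLin t v ≤ cumulativeLin t w) : discountedLin d v ≤ discountedLin d w := by
  have := discountedLin_nonneg hd (v := w - v) fun t => by
    rw [map_sub]; exact sub_nonneg.2 (h t)
  rw [map_sub] at this
  exact sub_nonneg.1 this

lemma absStream_eq_self {v : PayoffStream} (h : ∀ t, 0 ≤ cumulativeLin t v) : absStream v = v :=
  stream_ext' fun t => by rw [cumulativeLin_absStream, abs_of_nonneg (h t)]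

lemma absStream_smul (c : ℝ) (v : PayoffStream) : absStream (c • v) = |c| • absStream v :=
  stream_ext' fun t => by simp [cumulativeLin_absStream, abs_mul]

lemma cpfNorm_smul (c : ℝ) (v : PayoffStream) : cpfNorm d (c • v) = |c| * cpfNorm d v := by
  simp [cpfNorm, absStream_smul]

lemma cpfNorm_neg (v : PayoffStream) : cpfNorm d (-v) = cpfNorm d v := by
  have := cpfNorm_smul (d := d) (-1) v
  simpa using this

lemma cpfNorm_pos (hd : IsDiscountFunction d) {v : PayoffStream} (hv : v ≠ 0) :
    0 < cpfNorm d v := by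
  refine discountedLin_pos hd (fun t => by rw [cumulativeLin_absStream]; exact abs_nonneg _) ?_
  intro h
  refine hv (eq_zero_of_cumulativeLin v fun t _ => ?_)
  rw [← abs_eq_zero, ← cumulativeLin_absStream, h, map_zero]

lemma cpfNorm_add_le (hd : IsDiscountFunction d) (v w : PayoffStream) :
    cpfNorm d (v + w) ≤ cpfNorm d v + cpfNorm d w := by
  rw [cpfNorm, cpfNorm, cpfNorm, ← map_add]
  refine discountedLin_mono hd fun t => ?_
  simp only [map_add, cumulativeLin_absStream]
  exact abs_add_le _ _

lemma abs_cpfNorm_sub_le (hd : IsDiscountFunction d) (v w : PayoffStream) :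
    |cpfNorm d v - cpfNorm d w| ≤ cpfNorm d (v - w) := by
  have h1 := cpfNorm_add_le hd (v - w) w
  have h2 := cpfNorm_add_le hd (-(v - w)) v
  rw [cpfNorm_neg] at h2
  rw [sub_add_cancel] at h1
  rw [neg_sub, sub_add_cancel] at h2
  rw [abs_le]; constructor <;> linarith

lemma discountedLin_le_cpfNorm (hd : IsDiscountFunction d) (v : PayoffStream) :
    discountedLin d v ≤ cpfNorm d v :=
  discountedLin_mono hd fun t => by rw [cumulativeLin_absStream]; exact le_abs_self _

lemma abs_discountedLin_le (hd : IsDiscountFunction d) (v : PayoffStream) :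
    |discountedLin d v| ≤ cpfNorm d v := by
  refine abs_le'.2 ⟨discountedLin_le_cpfNorm hd v, ?_⟩
  rw [← map_neg, ← cpfNorm_neg]
  exact discountedLin_le_cpfNorm hd (-v)

/-- The difference of the two sides is DU of |v| - v, which is nonnegative and nonzero. -/
lemma discountedLin_lt_cpfNorm (hd : IsDiscountFunction d) {v : PayoffStream} {t : ℝ≥0}
    (h : cumulativeLin t v < 0) : discountedLin d v < cpfNorm d v := by
  have := discountedLin_pos hd (v := absStream v - v)
    (fun t => by rw [map_sub, cumulativeLin_absStream]; exact sub_nonneg.2 (le_abs_self _)) (by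
      intro h0
      have h1 := cumulativeLin_absStream v t
      rw [sub_eq_zero.1 h0] at h1
      linarith [abs_nonneg (cumulativeLin t v)])
  rw [map_sub] at this
  exact sub_pos.1 this

/-- |v| is dominated by a single payment of ε at date 0. This makes the CPF norm continuous for
uniform convergence of cumulative payoffs. -/
lemma cpfNorm_le_of_bound (hd : IsDiscountFunction d) {v : PayoffStream} {ε : ℝ}
    (h : ∀ t, |cumulativeLin t v| ≤ ε) : cpfNorm d v ≤ ε * d 0 := by
  have := discountedLin_mono hd (v := absStream v) (w := ε • unitAt 0) fun t => by
    rw [cumulativeLin_absStream, map_smul, cumulativeLin_unitAt]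
    simpa using h t
  rwa [map_smul, discountedLin_unitAt hd.top_eq_zero, smul_eq_mul] at this

/-- The signed normalized value `DU(v) / ‖v‖` of a difference of streams. -/
def cpfRatio (d : ℝ≥0∞ → ℝ) (v : PayoffStream) : ℝ := discountedLin d v / cpfNorm d v

lemma cpfRatio_smul {c : ℝ} (hc : 0 < c) (v : PayoffStream) :
    cpfRatio d (c • v) = cpfRatio d v := by
  rw [cpfRatio, cpfRatio, cpfNorm_smul, map_smul, smul_eq_mul, abs_of_pos hc,
    mul_div_mul_left _ _ hc.ne']

lemma cpfRatio_neg (v : PayoffStream) : cpfRatio d (-v) = -cpfRatio d v := by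
  rw [cpfRatio, cpfRatio, cpfNorm_neg, map_neg, neg_div]

lemma cpfRatio_mem (hd : IsDiscountFunction d) (v : PayoffStream) :
    cpfRatio d v ∈ Set.Icc (-1 : ℝ) 1 := by
  rw [Set.mem_Icc, ← abs_le, cpfRatio, abs_div]
  refine div_le_one_of_le₀ ?_ (abs_nonneg _)
  exact (abs_discountedLin_le hd v).trans (le_abs_self _)

lemma ratio_eq_cpfRatio (hd : IsDiscountFunction d) (x y : PayoffStream) :
    (discountedUtility d x - discountedUtility d y) / generalizedCPFDist d x y =
      cpfRatio d (x - y) := by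
  rw [cpfRatio, generalizedCPFDist_eq hd.top_eq_zero, discountedUtility_eq, discountedUtility_eq,
    map_sub]

/-! ### Coordinates relative to a grid -/

/-- The stream with normalized cumulative payoffs `a t` on the grid `T`. -/
def gridStream (d : ℝ≥0∞ → ℝ) (T : Finset ℝ≥0) (n : ℝ≥0 → ℝ≥0∞) : (T → ℝ) →ₗ[ℝ] PayoffStream where
  toFun a := ∑ t : T, (a t / (d (t : ℝ≥0) - d (n t))) • (unitAt (t : ℝ≥0) - unitAt (n t))
  map_add' a b := by
    simp only [Pi.add_apply, add_div, add_smul, Finset.sum_add_distrib]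
  map_smul' c a := by
    simp only [Pi.smul_apply, smul_eq_mul, mul_div_assoc, mul_smul, Finset.smul_sum,
      RingHom.id_apply]

variable {T : Finset ℝ≥0} {n : ℝ≥0 → ℝ≥0∞}

lemma gridStream_eq (a : T → ℝ) (c : ℝ≥0 → ℝ)
    (h : ∀ t : T, c t = a t / (d (t : ℝ≥0) - d (n t))) :
    gridStream d T n a = stepStream T n c := by
  rw [stepStream, ← Finset.sum_coe_sort T]
  exact Finset.sum_congr rfl fun t _ => by rw [h]

lemma gridStream_eq_stepStream (a : T → ℝ) :
    ∃ c : ℝ≥0 → ℝ, (∀ t : T, c t = a t / (d (t : ℝ≥0) - d (n t))) ∧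
      gridStream d T n a = stepStream T n c := by
  classical
  exact ⟨fun t => if h : t ∈ T then a ⟨t, h⟩ / (d t - d (n t)) else 0, fun t => by simp,
    gridStream_eq a _ fun t => by simp⟩

lemma support_gridStream (hn : IsSuccessor T n) (a : T → ℝ) :
    (gridStream d T n a).support ⊆ T := by
  obtain ⟨c, -, hc⟩ := gridStream_eq_stepStream (d := d) (n := n) a
  rw [hc]; exact support_stepStream hn c

lemma cumulativeLin_gridStream (hn : IsSuccessor T n) (a : T → ℝ) (t : T) :
    cumulativeLin t (gridStream d T n a) = a t / (d (t : ℝ≥0) - d (n t)) := by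
  obtain ⟨c, hc', hc⟩ := gridStream_eq_stepStream (d := d) (n := n) a
  rw [hc, cumulativeLin_stepStream_mem hn c t.2, hc']

lemma gap_pos (hd : IsDiscountFunction d) (hn : IsSuccessor T n) (t : T) :
    0 < d (t : ℝ≥0) - d (n t) := sub_pos.2 (hd.strictAnti (hn.lt t t.2))

lemma exists_gridStream (hd : IsDiscountFunction d) (hn : IsSuccessor T n) {v : PayoffStream}
    (hv : v.support ⊆ T) : ∃ a, gridStream d T n a = v :=
  ⟨fun t => cumulativeLin t v * (d (t : ℝ≥0) - d (n t)),
    stream_ext T (support_gridStream hn _) hv fun t ht => by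
      rw [cumulativeLin_gridStream hn _ ⟨t, ht⟩]
      exact mul_div_cancel_right₀ _ (gap_pos hd hn ⟨t, ht⟩).ne'⟩

lemma gridStream_eq_zero (hd : IsDiscountFunction d) (hn : IsSuccessor T n) {a : T → ℝ} :
    gridStream d T n a = 0 ↔ a = 0 := by
  constructor
  · intro h
    funext t
    have := cumulativeLin_gridStream (d := d) hn a t
    rw [h, map_zero, eq_comm, div_eq_zero_iff] at this
    exact this.resolve_right (gap_pos hd hn t).ne'
  · rintro rfl; simp

/-- The division by the gaps of d in `gridStream` serves to turn DU into the plain sum and the CPF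
norm into the ℓ¹ norm. -/
lemma discountedLin_gridStream (hd : IsDiscountFunction d) (hn : IsSuccessor T n) (a : T → ℝ) :
    discountedLin d (gridStream d T n a) = ∑ t, a t := by
  obtain ⟨c, hc', hc⟩ := gridStream_eq_stepStream (d := d) (n := n) a
  rw [hc, discountedLin_stepStream hd.top_eq_zero, ← Finset.sum_coe_sort T]
  exact Finset.sum_congr rfl fun t _ => by rw [hc', div_mul_cancel₀ _ (gap_pos hd hn t).ne']

lemma absStream_gridStream (hd : IsDiscountFunction d) (hn : IsSuccessor T n) (a : T → ℝ) :
    absStream (gridStream d T n a) = gridStream d T n fun t => |a t| := by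
  rw [← stepStream_abs hn (support_gridStream hn a)]
  refine (gridStream_eq _ _ fun t => ?_).symm
  rw [cumulativeLin_gridStream hn, abs_div, abs_of_pos (gap_pos hd hn t)]

lemma cpfNorm_gridStream (hd : IsDiscountFunction d) (hn : IsSuccessor T n) (a : T → ℝ) :
    cpfNorm d (gridStream d T n a) = ∑ t, |a t| := by
  rw [cpfNorm, absStream_gridStream hd hn, discountedLin_gridStream hd hn]

end Norm

/-! ### Ratio-dependence on finite index sets -/

section Transfer

lemma sum_le_sum_abs {κ : Type*} [Fintype κ] (a : κ → ℝ) : ∑ i, a i ≤ ∑ i, |a i| :=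
  Finset.sum_le_sum fun i _ => le_abs_self (a i)

lemma sum_abs_pos {κ : Type*} [Fintype κ] {a : κ → ℝ} (ha : a ≠ 0) : 0 < ∑ i, |a i| := by
  obtain ⟨i, hi⟩ := Function.ne_iff.1 ha
  exact Finset.sum_pos' (fun i _ => abs_nonneg _) ⟨i, Finset.mem_univ i, abs_pos.2 hi⟩

variable {ι : Type*} [DecidableEq ι]

/-- Moves the whole of coordinate `i` to coordinate `j`. -/
def transfer (a : ι → ℝ) (i j : ι) : ι → ℝ := a + a i • (Pi.single j 1 - Pi.single i 1)

lemma transfer_src (a : ι → ℝ) {i j : ι} (h : i ≠ j) : transfer a i j i = 0 := by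
  simp [transfer, h]

lemma transfer_tgt (a : ι → ℝ) {i j : ι} (h : i ≠ j) : transfer a i j j = a j + a i := by
  simp [transfer, h.symm]

lemma transfer_of_ne (a : ι → ℝ) {i j k : ι} (hi : k ≠ i) (hj : k ≠ j) :
    transfer a i j k = a k := by
  simp [transfer, hi, hj]

lemma transfer_of_eq_zero {a : ι → ℝ} {i : ι} (h : a i = 0) (j : ι) : transfer a i j = a := by
  simp [transfer, h]

/-- The vector `p` at `i` and `-q` at `j`. -/
def twoPoint (i j : ι) (p q : ℝ) : ι → ℝ := p • Pi.single i 1 - q • Pi.single j 1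

lemma twoPoint_fst {i j : ι} (h : i ≠ j) (p q : ℝ) : twoPoint i j p q i = p := by
  simp [twoPoint, h]

lemma twoPoint_snd {i j : ι} (h : i ≠ j) (p q : ℝ) : twoPoint i j p q j = -q := by
  simp [twoPoint, h.symm]

lemma twoPoint_of_ne {i j k : ι} (hi : k ≠ i) (hj : k ≠ j) (p q : ℝ) :
    twoPoint i j p q k = 0 := by
  simp [twoPoint, hi, hj]

lemma twoPoint_smul (i j : ι) (c p q : ℝ) :
    c • twoPoint i j p q = twoPoint i j (c * p) (c * q) := by
  rw [twoPoint, twoPoint]; module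

variable [Fintype ι]

lemma sum_transfer (a : ι → ℝ) (i j : ι) : ∑ k, transfer a i j k = ∑ k, a k := by
  simp [transfer, Finset.sum_add_distrib, ← Finset.mul_sum]

lemma sum_abs_transfer {a : ι → ℝ} {i j : ι} (hij : i ≠ j) (h : 0 ≤ a i * a j) :
    ∑ k, |transfer a i j k| = ∑ k, |a k| := by
  have : ∀ k, |transfer a i j k| = transfer (fun k => |a k|) i j k := by
    intro k
    by_cases hi : k = i
    · subst hi; simp [transfer_src _ hij]
    by_cases hj : k = j
    · subst hj
      rw [transfer_tgt _ hij, transfer_tgt _ hij]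
      rw [abs_add_eq_add_abs_iff]
      rcases mul_nonneg_iff.1 h with h | h
      · exact Or.inl ⟨h.2, h.1⟩
      · exact Or.inr ⟨h.2, h.1⟩
    · rw [transfer_of_ne _ hi hj, transfer_of_ne _ hi hj]
  rw [Finset.sum_congr rfl fun k _ => this k, sum_transfer]

/-- The properties of `f a = ρ(x, y)` in grid coordinates `a` of `x - y`. -/
structure IsTransferMonotone (f : (ι → ℝ) → ℝ) : Prop where
  smul : ∀ (a : ι → ℝ) (c : ℝ), a ≠ 0 → 0 < c → f (c • a) = f a
  transitivity : ∀ u v : ι → ℝ, u ≠ 0 → v ≠ 0 → u + v ≠ 0 → 0 ≤ ∑ i, u i → 0 ≤ ∑ i, v i →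
    min (f u) (f v) < f (u + v) ∨ (f (u + v) = f u ∧ f u = f v)
  le_transfer : ∀ a : ι → ℝ, 0 ≤ ∑ i, a i → ∀ i j, i ≠ j → a i ≠ 0 → transfer a i j ≠ 0 →
    f a ≤ f (transfer a i j)
  dominance : ∀ a e : ι → ℝ, a ≠ 0 → e ≠ 0 → 0 ≤ e → ¬ 0 ≤ a → f a < f e

variable {f : (ι → ℝ) → ℝ}

/-- Both transfers between i and j weakly raise f, while `a` is a convex combination of them.
Transitivity would put f(a) strictly above the smaller of their values unless all three agree. -/
lemma IsTransferMonotone.eq_of_mul_pos (hf : IsTransferMonotone f) {a : ι → ℝ}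
    (ha : 0 ≤ ∑ i, a i) {i j : ι} (hij : i ≠ j) (h : 0 < a i * a j) :
    f a = f (transfer a i j) := by
  have hi : a i ≠ 0 := left_ne_zero_of_mul h.ne'
  have hj : a j ≠ 0 := right_ne_zero_of_mul h.ne'
  have hs : a j + a i ≠ 0 := by
    intro h0
    have : a j = -a i := by linarith
    rw [this] at h
    nlinarith [mul_self_nonneg (a i)]
  have hb : transfer a i j ≠ 0 := fun h0 => hs (by
    rw [← transfer_tgt a hij, h0]; rfl)
  have hb' : transfer a j i ≠ 0 := fun h0 => hs (by
    rw [add_comm, ← transfer_tgt a hij.symm, h0]; rfl)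
  have h1 := hf.le_transfer a ha i j hij hi hb
  have h2 := hf.le_transfer a ha j i hij.symm hj hb'
  -- The weights of the convex combination; they are positive because the two coordinates have the
  -- same sign.
  have hl : 0 < a j / (a j + a i) := by
    have : a j / (a j + a i) = (a j * a j + a i * a j) / (a j + a i) ^ 2 := by
      field_simp
    rw [this]; have := mul_self_nonneg (a j); positivity
  have hm : 0 < a i / (a j + a i) := by
    have : a i / (a j + a i) = (a i * a i + a i * a j) / (a j + a i) ^ 2 := by
      field_simp; ring
    rw [this]; have := mul_self_nonneg (a i); positivity
  have hsum : (a j / (a j + a i)) • transfer a i j +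
      (a i / (a j + a i)) • transfer a j i = a := by
    funext k
    simp only [transfer, Pi.add_apply, Pi.smul_apply, Pi.sub_apply, smul_eq_mul]
    field_simp
    ring
  have h3 := hf.transitivity _ _ (smul_ne_zero hl.ne' hb) (smul_ne_zero hm.ne' hb')
    (by rw [hsum]; rintro rfl; exact hi rfl)
    (by simp only [Pi.smul_apply, smul_eq_mul, ← Finset.mul_sum, sum_transfer]; positivity)
    (by simp only [Pi.smul_apply, smul_eq_mul, ← Finset.mul_sum, sum_transfer]; positivity)
  rw [hsum, hf.smul _ _ hb hl, hf.smul _ _ hb' hm] at h3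
  rcases h3 with h3 | h3
  · exact absurd h3 (not_lt.2 (le_min h1 h2))
  · exact h3.1

lemma IsTransferMonotone.eq_of_mul_nonneg (hf : IsTransferMonotone f) {a : ι → ℝ}
    (ha : 0 ≤ ∑ i, a i) {i j : ι} (hij : i ≠ j) (h : 0 ≤ a i * a j) :
    f a = f (transfer a i j) := by
  by_cases hi : a i = 0
  · rw [transfer_of_eq_zero hi]
  rcases h.lt_or_eq with h | h
  · exact hf.eq_of_mul_pos ha hij h
  have hj : a j = 0 := (mul_eq_zero.1 h.symm).resolve_left hi
  -- When coordinate j is empty, move only half of coordinate i: the two transfers of the resulting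
  -- `c` are `a` and `transfer a i j`.
  set c : ι → ℝ := a + (a i / 2) • (Pi.single j 1 - Pi.single i 1) with hc
  have hci : c i = a i / 2 := by simp [hc, hij]; ring
  have hcj : c j = a i / 2 := by simp [hc, hij.symm, hj]
  have hcs : 0 ≤ ∑ k, c k := by
    simpa [hc, Finset.sum_add_distrib, ← Finset.mul_sum] using ha
  have hp : 0 < c i * c j := by
    rw [hci, hcj]; exact mul_self_pos.2 (by simpa using hi)
  have h1 := hf.eq_of_mul_pos hcs hij hp
  have h2 := hf.eq_of_mul_pos hcs hij.symm (by rwa [mul_comm])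
  have e1 : transfer c i j = transfer a i j := by
    rw [transfer, transfer, hci, hc]; module
  have e2 : transfer c j i = a := by
    rw [transfer, hcj, hc]; module
  rw [← e1, ← h1, h2, e2]

lemma sum_twoPoint (i j : ι) (p q : ℝ) : ∑ k, twoPoint i j p q k = p - q := by
  simp [twoPoint, ← Finset.mul_sum]

/-- Merge same-sign coordinates until at most one of each sign is left. Merging preserves the total
positive mass (∑|a| + ∑a)/2 and the total negative mass (∑|a| - ∑a)/2, which therefore are the two
remaining entries. -/
lemma IsTransferMonotone.exists_twoPoint [Nontrivial ι] (hf : IsTransferMonotone f) (m : ℕ) :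
    ∀ a : ι → ℝ, (Finset.univ.filter fun i => a i ≠ 0).card ≤ m → a ≠ 0 → 0 ≤ ∑ i, a i →
      ∃ i j, i ≠ j ∧
        f a = f (twoPoint i j ((∑ k, |a k| + ∑ k, a k) / 2) ((∑ k, |a k| - ∑ k, a k) / 2)) := by
  induction m with
  | zero =>
    intro a hm ha _
    exfalso
    apply ha
    funext i
    by_contra hi
    exact Finset.card_ne_zero_of_mem (Finset.mem_filter.2 ⟨Finset.mem_univ i, hi⟩)
      (Nat.le_zero.1 hm)
  | succ m ih =>
    intro a hm ha hs
    by_cases h : ∃ i j, i ≠ j ∧ 0 < a i * a j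
    · obtain ⟨i, j, hij, hp⟩ := h
      have hi : a i ≠ 0 := left_ne_zero_of_mul hp.ne'
      have hj : a j ≠ 0 := right_ne_zero_of_mul hp.ne'
      have hb : transfer a i j ≠ 0 := by
        intro h0
        have h1 := transfer_tgt a hij
        rw [h0, Pi.zero_apply] at h1
        have : a j = -a i := by linarith
        rw [this] at hp
        nlinarith [mul_self_nonneg (a i)]
      have hcard : (Finset.univ.filter fun k => transfer a i j k ≠ 0).card ≤ m := by
        refine Nat.lt_succ_iff.1 (lt_of_lt_of_le (Finset.card_lt_card ?_) hm)
        refine (Finset.ssubset_iff_of_subset ?_).2 ⟨i, by simp [hi], by simp [transfer_src a hij]⟩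
        intro k hk
        simp only [Finset.mem_filter, Finset.mem_univ, true_and] at hk ⊢
        by_cases hki : k = i
        · subst hki; exact hi
        by_cases hkj : k = j
        · subst hkj; exact hj
        rwa [transfer_of_ne a hki hkj] at hk
      have := ih _ hcard hb (by rwa [sum_transfer])
      rwa [sum_transfer, sum_abs_transfer hij hp.le, ← hf.eq_of_mul_pos hs hij hp] at this
    · push Not at h
      obtain ⟨i, hi⟩ : ∃ i, 0 < a i := by
        by_contra! hneg
        have h0 := (Finset.sum_eq_zero_iff_of_nonpos (s := Finset.univ) fun i _ => hneg i).1
          (le_antisymm (Finset.sum_nonpos fun i _ => hneg i) hs)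
        exact ha (funext fun i => h0 i (Finset.mem_univ i))
      have hnp : ∀ k, k ≠ i → a k ≤ 0 := fun k hk => by
        by_contra hpos
        exact absurd (mul_pos hi (not_le.1 hpos)) (not_lt.2 (h i k hk.symm))
      -- Without a negative coordinate any other index serves as j, with entry 0.
      obtain ⟨j, hj, hz⟩ : ∃ j, j ≠ i ∧ ∀ k, k ≠ i → k ≠ j → a k = 0 := by
        by_cases hneg : ∃ j, a j < 0
        · obtain ⟨j, hj⟩ := hneg
          refine ⟨j, by rintro rfl; linarith, fun k hk hkj => ?_⟩
          refine le_antisymm (hnp k hk) ?_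
          by_contra hlt
          exact absurd (mul_pos_of_neg_of_neg (not_le.1 hlt) hj) (not_lt.2 (h k j hkj))
        · push Not at hneg
          obtain ⟨j, hj⟩ := exists_ne i
          exact ⟨j, hj, fun k hk _ => le_antisymm (hnp k hk) (hneg k)⟩
      refine ⟨i, j, hj.symm, ?_⟩
      have e : a = twoPoint i j (a i) (-a j) := by
        funext k
        by_cases hki : k = i
        · subst hki; rw [twoPoint_fst hj.symm]
        by_cases hkj : k = j
        · subst hkj; rw [twoPoint_snd hj.symm, neg_neg]
        rw [twoPoint_of_ne hki hkj, hz k hki hkj]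
      have s1 : ∑ k, a k = a i + a j := by
        rw [Finset.sum_eq_add i j hj.symm] <;> simp
        exact fun k hk hk' => hz k hk hk'
      have s2 : ∑ k, |a k| = a i - a j := by
        rw [Finset.sum_eq_add i j hj.symm]
        · rw [abs_of_pos hi, abs_of_nonpos (hnp j hj)]; ring
        · exact fun k _ hk => by rw [hz k hk.1 hk.2, abs_zero]
        · simp
        · simp
      rw [s1, s2]
      conv_lhs => rw [e]
      congr 2 <;> ring

/-- Entries move one at a time into empty coordinates; the intermediate position (i', j) requires i'
≠ j. -/
lemma IsTransferMonotone.twoPoint_move (hf : IsTransferMonotone f) {p q : ℝ}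
    (hpq : q ≤ p) {i j i' j' : ι} (hij : i ≠ j) (h1 : i' ≠ j) (h2 : i' ≠ j') :
    f (twoPoint i j p q) = f (twoPoint i' j' p q) := by
  have hfst : ∀ i i' j : ι, i ≠ j → i' ≠ j →
      f (twoPoint i j p q) = f (twoPoint i' j p q) := by
    intro i i' j hij hij'
    by_cases hii : i = i'
    · rw [hii]
    rw [hf.eq_of_mul_nonneg (by rw [sum_twoPoint]; linarith) hii
      (by rw [twoPoint_of_ne (Ne.symm hii) hij', mul_zero])]
    congr 1
    rw [transfer, twoPoint_fst hij, twoPoint, twoPoint]; module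
  have hsnd : ∀ i j j' : ι, i ≠ j → i ≠ j' →
      f (twoPoint i j p q) = f (twoPoint i j' p q) := by
    intro i j j' hij hij'
    by_cases hjj : j = j'
    · rw [hjj]
    rw [hf.eq_of_mul_nonneg (by rw [sum_twoPoint]; linarith) hjj
      (by rw [twoPoint_of_ne (Ne.symm hij') (Ne.symm hjj), mul_zero])]
    congr 1
    rw [transfer, twoPoint_snd hij, twoPoint, twoPoint]; module
  rw [hfst i i' j hij h1, hsnd i' j j' h1 h2]

lemma IsTransferMonotone.twoPoint_eq (hf : IsTransferMonotone f) (hι : 2 < Fintype.card ι)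
    {p q : ℝ} (hpq : q ≤ p) {i j i' j' : ι} (hij : i ≠ j) (hij' : i' ≠ j') :
    f (twoPoint i j p q) = f (twoPoint i' j' p q) := by
  by_cases h : i' = j
  · subst h
    -- When the positive entry has to go where the negative one sits, the latter first steps aside
    -- to a third index. This is why three dates are needed.
    obtain ⟨k, hk⟩ : ∃ k, k ∉ ({i, i'} : Finset ι) := by
      by_contra! hall
      have : Finset.univ ⊆ ({i, i'} : Finset ι) := fun k _ => hall k
      have := (Finset.card_le_card this).trans Finset.card_le_two
      rw [Finset.card_univ] at this
      omega
    simp only [Finset.mem_insert, Finset.mem_singleton, not_or] at hk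
    rw [hf.twoPoint_move hpq hij hij (Ne.symm hk.1),
      hf.twoPoint_move hpq (Ne.symm hk.1) (Ne.symm hk.2) hij']
  · exact hf.twoPoint_move hpq hij h hij'

/-- Dividing the two-point vector by half the ℓ¹ norm leaves the entries 1 + r and -(1 - r), which
depend only on the ratio r. -/
lemma IsTransferMonotone.reduce (hf : IsTransferMonotone f) (hι : 2 < Fintype.card ι)
    {i j : ι} (hij : i ≠ j) {a : ι → ℝ} (ha : a ≠ 0) (hs : 0 ≤ ∑ k, a k) :
    f a = f (twoPoint i j (1 + (∑ k, a k) / ∑ k, |a k|) (1 - (∑ k, a k) / ∑ k, |a k|)) := by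
  have : Nontrivial ι := ⟨i, j, hij⟩
  obtain ⟨i', j', hij', h⟩ := hf.exists_twoPoint _ a le_rfl ha hs
  have hN := sum_abs_pos ha
  have hc : 0 < (∑ k, |a k|) / 2 := by positivity
  have e : twoPoint i' j' ((∑ k, |a k| + ∑ k, a k) / 2) ((∑ k, |a k| - ∑ k, a k) / 2) =
      ((∑ k, |a k|) / 2) • twoPoint i' j' (1 + (∑ k, a k) / ∑ k, |a k|)
        (1 - (∑ k, a k) / ∑ k, |a k|) := by
    rw [twoPoint_smul]
    congr 1 <;> field_simp
  have hr : 0 ≤ (∑ k, a k) / ∑ k, |a k| := by positivity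
  rw [h, e, hf.smul _ _ _ hc, hf.twoPoint_eq hι (by linarith) hij' hij]
  intro h0
  have := congrFun h0 i'
  rw [twoPoint_fst hij', Pi.zero_apply] at this
  linarith

theorem IsTransferMonotone.eq_of_ratio_eq (hf : IsTransferMonotone f) (hι : 2 < Fintype.card ι)
    {a b : ι → ℝ} (ha : a ≠ 0) (hb : b ≠ 0) (hs : 0 ≤ ∑ k, a k)
    (h : (∑ k, a k) / ∑ k, |a k| = (∑ k, b k) / ∑ k, |b k|) : f a = f b := by
  have : Nontrivial ι := Fintype.one_lt_card_iff_nontrivial.1 (by omega)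
  obtain ⟨i, j, hij⟩ := exists_pair_ne ι
  have hsb : 0 ≤ ∑ k, b k := by
    have h1 : 0 ≤ (∑ k, b k) / ∑ k, |b k| := h ▸ div_nonneg hs (sum_abs_pos ha).le
    by_contra hneg
    exact absurd (div_neg_of_neg_of_pos (not_le.1 hneg) (sum_abs_pos hb)) (not_lt.2 h1)
  rw [hf.reduce hι hij ha hs, hf.reduce hι hij hb hsb, h]

theorem IsTransferMonotone.lt_of_ratio_lt (hf : IsTransferMonotone f) (hι : 2 < Fintype.card ι)
    {a b : ι → ℝ} (ha : a ≠ 0) (hb : b ≠ 0) (hs : 0 ≤ ∑ k, a k)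
    (h : (∑ k, a k) / ∑ k, |a k| < (∑ k, b k) / ∑ k, |b k|) : f a < f b := by
  have : Nontrivial ι := Fintype.one_lt_card_iff_nontrivial.1 (by omega)
  obtain ⟨i, j, hij⟩ := exists_pair_ne ι
  have h0 : 0 ≤ (∑ k, a k) / ∑ k, |a k| := div_nonneg hs (sum_abs_pos ha).le
  have hsb : 0 ≤ ∑ k, b k := by
    by_contra hneg
    exact absurd (div_neg_of_neg_of_pos (not_le.1 hneg) (sum_abs_pos hb))
      (not_lt.2 (h0.trans h.le))
  have h1 : (∑ k, b k) / ∑ k, |b k| ≤ 1 := div_le_one_of_le₀ (sum_le_sum_abs b) (sum_abs_pos hb).le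
  rw [hf.reduce hι hij ha hs, hf.reduce hι hij hb hsb]
  generalize (∑ k, a k) / ∑ k, |a k| = r at *
  generalize (∑ k, b k) / ∑ k, |b k| = s at *
  have hne : ∀ p q : ℝ, 0 < p → twoPoint i j p q ≠ 0 := fun p q hp h0 => by
    have := congrFun h0 i
    rw [twoPoint_fst hij, Pi.zero_apply] at this
    linarith
  have hneg : ∀ p q : ℝ, 0 < q → ¬ 0 ≤ twoPoint i j p q := fun p q hq h0 => by
    have := h0 j
    rw [twoPoint_snd hij, Pi.zero_apply] at this
    linarith
  have hsingle : ∀ p : ℝ, 0 < p → 0 ≤ twoPoint i j p 0 := fun p hp k => by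
    by_cases hk : k = i
    · subst hk; rw [twoPoint_fst hij]; exact hp.le
    · simp [twoPoint, hk]
  rcases h1.lt_or_eq with h1 | rfl
  -- Rescale the vector of ratio s so that its negative entry becomes -(1 - r). It then exceeds the
  -- vector of ratio r by a positive multiple of a unit vector, which has a larger f by dominance;
  -- transitivity makes the sum strictly better.
  · have hc : 0 < (1 - r) / (1 - s) := div_pos (by linarith) (by linarith)
    have hp : 0 < (1 - r) / (1 - s) * (1 + s) - (1 + r) := by
      have : (1 - r) / (1 - s) * (1 + s) - (1 + r) = 2 * (s - r) / (1 - s) := by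
        have : 1 - s ≠ 0 := by linarith
        field_simp; ring
      rw [this]; exact div_pos (by linarith) (by linarith)
    rw [← hf.smul (twoPoint i j (1 + s) _) _ (hne _ _ (by linarith)) hc, twoPoint_smul,
      div_mul_cancel₀ _ (by linarith : (1 - s) ≠ 0)]
    have e : twoPoint i j ((1 - r) / (1 - s) * (1 + s)) (1 - r) =
        twoPoint i j (1 + r) (1 - r) +
          twoPoint i j ((1 - r) / (1 - s) * (1 + s) - (1 + r)) 0 := by
      simp only [twoPoint]; module
    have hdom := hf.dominance _ _ (hne (1 + r) (1 - r) (by linarith)) (hne _ 0 hp)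
      (hsingle _ hp) (hneg _ _ (by linarith))
    have := hf.transitivity _ _ (hne (1 + r) (1 - r) (by linarith)) (hne _ 0 hp)
      (by rw [← e]; exact hne _ _ (by linarith)) (by rw [sum_twoPoint]; linarith)
      (by rw [sum_twoPoint]; linarith)
    rw [← e, min_eq_left hdom.le] at this
    rcases this with h | h
    · exact h
    · exact absurd h.2 hdom.ne
  -- At ratio 1 the negative entry vanishes and dominance applies directly.
  · rw [sub_self]
    exact hf.dominance _ _ (hne _ _ (by linarith)) (hne _ _ (by linarith))
      (hsingle _ (by linarith)) (hneg _ _ (by linarith))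

end Transfer

/-! ### From the representation to the axioms -/

lemma cpfNorm_zero (d : ℝ≥0∞ → ℝ) : cpfNorm d 0 = 0 := by
  have := cpfNorm_smul (d := d) 0 0
  simpa using this

/-- A line of streams along which the CPF norm is `1` and the ratio takes every value. -/
lemma exists_ratio_line {d : ℝ≥0∞ → ℝ} (hd : IsDiscountFunction d) :
    ∃ u w : PayoffStream, ∀ r ∈ Set.Icc (-1 : ℝ) 1,
      u + r • w ≠ 0 ∧ cpfRatio d (u + r • w) = r := by
  obtain ⟨T, hT⟩ : ∃ T : Finset ℝ≥0, T = {0, 1} := ⟨_, rfl⟩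
  obtain ⟨n, hn⟩ := exists_isSuccessor T
  have hsum : ∀ g : ℝ≥0 → ℝ, ∑ t : T, g t = g 0 + g 1 := fun g => by
    rw [Finset.sum_coe_sort T g, hT, Finset.sum_pair zero_ne_one]
  -- The grid coordinates are (1 + r)/2 at date 0 and -(1 - r)/2 at date 1, with sum r and ℓ¹ norm
  -- 1.
  refine ⟨gridStream d T n fun t => if (t : ℝ≥0) = 0 then 1 / 2 else -(1 / 2),
    gridStream d T n fun _ => 1 / 2, fun r hr => ?_⟩
  rw [← map_smul, ← map_add]
  set a : T → ℝ := (fun t : T => if (t : ℝ≥0) = 0 then (1 / 2 : ℝ) else -(1 / 2)) +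
    r • fun _ : T => (1 / 2 : ℝ) with ha
  have h1 : ∑ t, a t = r := by
    refine (hsum fun t => (if t = 0 then (1 / 2 : ℝ) else -(1 / 2)) + r * (1 / 2)).trans ?_
    simp
    ring
  have h2 : ∑ t, |a t| = 1 := by
    refine (hsum fun t => |(if t = 0 then (1 / 2 : ℝ) else -(1 / 2)) + r * (1 / 2)|).trans ?_
    rw [if_pos rfl, if_neg one_ne_zero, abs_of_nonneg (by linarith [hr.1]),
      abs_of_nonpos (by linarith [hr.2])]
    ring
  have h3 := cpfNorm_gridStream hd hn a
  rw [h2] at h3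
  refine ⟨fun h0 => ?_, ?_⟩
  · rw [h0, cpfNorm_zero] at h3; exact zero_ne_one h3
  · rw [cpfRatio, h3, discountedLin_gridStream hd hn, h1, div_one]

lemma cpfRatio_nonneg_iff {d : ℝ≥0∞ → ℝ} (hd : IsDiscountFunction d) {v : PayoffStream}
    (hv : v ≠ 0) : 0 ≤ cpfRatio d v ↔ 0 ≤ discountedLin d v :=
  ⟨fun h => le_of_not_gt fun h' => absurd (div_neg_of_neg_of_pos h' (cpfNorm_pos hd hv))
    (not_lt.2 h), fun h => div_nonneg h (cpfNorm_pos hd hv).le⟩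

lemma cpfRatio_eq_zero_iff {d : ℝ≥0∞ → ℝ} (hd : IsDiscountFunction d) {v : PayoffStream}
    (hv : v ≠ 0) : cpfRatio d v = 0 ↔ discountedLin d v = 0 := by
  rw [cpfRatio, div_eq_zero_iff, or_iff_left (cpfNorm_pos hd hv).ne']

section Representation

variable {ρ : PayoffStream → PayoffStream → ℝ} {G : ℝ → ℝ} {d : ℝ≥0∞ → ℝ}

namespace IsGeneralizedCPFRepresentation

lemma eq_ratio (h : IsGeneralizedCPFRepresentation ρ G d) {x y : PayoffStream} (hxy : x ≠ y) :
    ρ x y = G (cpfRatio d (x - y)) := by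
  rw [h.represents x y hxy, ratio_eq_cpfRatio h.discount]

/-- Swapping the two options negates the ratio, so at ratio 0 both choice probabilities equal G(0)
and add up to 1. -/
lemma map_zero_eq_half (h : IsGeneralizedCPFRepresentation ρ G d) (hρ : IsBinaryChoiceRule ρ) :
    G 0 = 1 / 2 := by
  obtain ⟨u, w, huw⟩ := exists_ratio_line h.discount
  obtain ⟨h0, hr⟩ := huw 0 (by norm_num)
  have h1 := (hρ _ _ h0).2
  rw [h.eq_ratio h0, h.eq_ratio h0.symm, sub_zero, zero_sub, cpfRatio_neg, hr, neg_zero] at h1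
  linarith

lemma half_le_iff (h : IsGeneralizedCPFRepresentation ρ G d) (hρ : IsBinaryChoiceRule ρ)
    {x y : PayoffStream} (hxy : x ≠ y) : 1 / 2 ≤ ρ x y ↔ 0 ≤ discountedLin d (x - y) := by
  rw [h.eq_ratio hxy, ← h.map_zero_eq_half hρ, h.strictMonoOn.le_iff_le (by norm_num)
    (cpfRatio_mem h.discount _), cpfRatio_nonneg_iff h.discount (sub_ne_zero.2 hxy)]

lemma eq_half_iff (h : IsGeneralizedCPFRepresentation ρ G d) (hρ : IsBinaryChoiceRule ρ)
    {x y : PayoffStream} (hxy : x ≠ y) : ρ x y = 1 / 2 ↔ discountedLin d (x - y) = 0 := by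
  rw [h.eq_ratio hxy, ← h.map_zero_eq_half hρ, h.strictMonoOn.injOn.eq_iff
    (cpfRatio_mem h.discount _) (by norm_num), cpfRatio_eq_zero_iff h.discount (sub_ne_zero.2 hxy)]

lemma half_lt_iff (h : IsGeneralizedCPFRepresentation ρ G d) (hρ : IsBinaryChoiceRule ρ)
    {x y : PayoffStream} (hxy : x ≠ y) : 1 / 2 < ρ x y ↔ 0 < discountedLin d (x - y) := by
  rw [lt_iff_le_and_ne, lt_iff_le_and_ne, h.half_le_iff hρ hxy, ne_comm, Ne, h.eq_half_iff hρ hxy,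
    ne_comm]

lemma tendsto_cpfNorm_sub [TopologicalSpace PayoffStream]
    (hτ : IsAdmissibleTopology ‹TopologicalSpace PayoffStream›) (hd : IsDiscountFunction d)
    (x : PayoffStream) :
    Filter.Tendsto (fun y => cpfNorm d (y - x)) (nhds x) (nhds 0) := by
  rw [Metric.tendsto_nhds]
  intro ε hε
  have hd0 : 0 < d 0 := by simpa using hd.coe_pos 0
  filter_upwards [hτ.uniform_nhds x (ε / (2 * d 0)) (by positivity)] with y hy
  have h1 : cpfNorm d (y - x) ≤ ε / (2 * d 0) * d 0 := cpfNorm_le_of_bound hd fun t => by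
    rw [map_sub, ← cumulativePayoff_coe, ← cumulativePayoff_coe]
    exact (hy t).le
  have h2 : ε / (2 * d 0) * d 0 = ε / 2 := by field_simp
  rw [Real.dist_eq, sub_zero, abs_of_nonneg ((abs_nonneg _).trans (abs_discountedLin_le hd _))]
  linarith

/-- DU and the CPF norm are both 1-Lipschitz for the CPF norm, which is itself controlled by the
topology. -/
lemma continuity [TopologicalSpace PayoffStream]
    (hτ : IsAdmissibleTopology ‹TopologicalSpace PayoffStream›)
    (h : IsGeneralizedCPFRepresentation ρ G d) : Continuity ρ := by
  have hd := h.discount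
  have key : ∀ p : PayoffStream × PayoffStream, Filter.Tendsto
      (fun q : PayoffStream × PayoffStream => cpfNorm d ((q.1 - q.2) - (p.1 - p.2)))
      (nhds p) (nhds 0) := by
    intro p
    have h1 := (tendsto_cpfNorm_sub hτ hd p.1).comp (continuous_fst.tendsto p)
    have h2 := (tendsto_cpfNorm_sub hτ hd p.2).comp (continuous_snd.tendsto p)
    have h3 := h1.add h2
    rw [add_zero] at h3
    refine squeeze_zero (fun q => (abs_nonneg _).trans (abs_discountedLin_le hd _)) (fun q => ?_) h3
    have := cpfNorm_add_le hd (q.1 - p.1) (-(q.2 - p.2))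
    rw [cpfNorm_neg] at this
    rwa [show q.1 - q.2 - (p.1 - p.2) = q.1 - p.1 + -(q.2 - p.2) by abel]
  have hN : Continuous fun q : PayoffStream × PayoffStream => cpfNorm d (q.1 - q.2) := by
    rw [continuous_iff_continuousAt]
    intro p
    rw [ContinuousAt, tendsto_iff_dist_tendsto_zero]
    exact squeeze_zero (fun q => dist_nonneg) (fun q => abs_cpfNorm_sub_le hd _ _) (key p)
  have hD : Continuous fun q : PayoffStream × PayoffStream => discountedLin d (q.1 - q.2) := by
    rw [continuous_iff_continuousAt]
    intro p
    rw [ContinuousAt, tendsto_iff_dist_tendsto_zero]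
    refine squeeze_zero (fun q => dist_nonneg) (fun q => ?_) (key p)
    rw [Real.dist_eq, ← map_sub]
    exact abs_discountedLin_le hd _
  have hR : ContinuousOn (fun q : PayoffStream × PayoffStream => cpfRatio d (q.1 - q.2))
      {p | p.1 ≠ p.2} :=
    hD.continuousOn.div hN.continuousOn fun p hp => (cpfNorm_pos hd (sub_ne_zero.2 hp)).ne'
  exact (h.continuousOn.comp hR fun p _ => cpfRatio_mem hd _).congr fun p hp => h.eq_ratio hp

lemma linearity (h : IsGeneralizedCPFRepresentation ρ G d) : Linearity ρ := by
  intro x y z hxy l hl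
  have e : l • x + (1 - l) • z - (l • y + (1 - l) • z) = l • (x - y) := by module
  have hne : l • x + (1 - l) • z ≠ l • y + (1 - l) • z := by
    rw [← sub_ne_zero, e]
    exact smul_ne_zero hl.1.ne' (sub_ne_zero.2 hxy)
  rw [h.eq_ratio hxy, h.eq_ratio hne, e, cpfRatio_smul hl.1]

/-- By the triangle inequality, the ratio of x - z is at least an average, with positive weights, of
the ratios of x - y and y - z. It thus exceeds their minimum when they differ. -/
lemma moderateTransitivity (h : IsGeneralizedCPFRepresentation ρ G d) (hρ : IsBinaryChoiceRule ρ) :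
    ModerateTransitivity ρ := by
  intro x y z hxy hyz hxz h1 h2
  have hd := h.discount
  rw [h.half_le_iff hρ hxy] at h1
  rw [h.half_le_iff hρ hyz] at h2
  have n1 := cpfNorm_pos hd (sub_ne_zero.2 hxy)
  have n2 := cpfNorm_pos hd (sub_ne_zero.2 hyz)
  have n3 := cpfNorm_pos hd (sub_ne_zero.2 hxz)
  have htri := cpfNorm_add_le hd (x - y) (y - z)
  have hadd := map_add (discountedLin d) (x - y) (y - z)
  rw [sub_add_sub_cancel] at htri hadd
  rw [h.eq_ratio hxy, h.eq_ratio hyz, h.eq_ratio hxz]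
  have m1 := cpfRatio_mem hd (x - y)
  have m2 := cpfRatio_mem hd (y - z)
  have m3 := cpfRatio_mem hd (x - z)
  have e1 : discountedLin d (x - y) = cpfRatio d (x - y) * cpfNorm d (x - y) :=
    (div_mul_cancel₀ _ n1.ne').symm
  have e2 : discountedLin d (y - z) = cpfRatio d (y - z) * cpfNorm d (y - z) :=
    (div_mul_cancel₀ _ n2.ne').symm
  have e3 : cpfRatio d (x - z) * cpfNorm d (x - z) = discountedLin d (x - z) :=
    div_mul_cancel₀ _ n3.ne'
  have r1 := (cpfRatio_nonneg_iff hd (sub_ne_zero.2 hxy)).2 h1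
  have r2 := (cpfRatio_nonneg_iff hd (sub_ne_zero.2 hyz)).2 h2
  rw [hadd, e1, e2] at e3
  generalize cpfRatio d (x - y) = a at *
  generalize cpfRatio d (y - z) = b at *
  generalize cpfRatio d (x - z) = c at *
  generalize cpfNorm d (x - y) = p at *
  generalize cpfNorm d (y - z) = q at *
  generalize cpfNorm d (x - z) = s at *
  have hc : 0 ≤ c := by
    by_contra hneg
    nlinarith [mul_nonneg r1 n1.le, mul_nonneg r2 n2.le]
  have hle : a * p + b * q ≤ c * (p + q) := by
    rw [← e3]; exact mul_le_mul_of_nonneg_left htri hc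
  rcases lt_trichotomy a b with hab | hab | hab
  · left
    rw [min_lt_iff, h.strictMonoOn.lt_iff_lt m1 m3]
    left
    nlinarith
  · subst hab
    have : a ≤ c := by
      have : a * (p + q) ≤ c * (p + q) := by linarith
      exact le_of_mul_le_mul_right this (by linarith)
    rw [min_self]
    rcases this.lt_or_eq with h' | h'
    · exact Or.inl (h.strictMonoOn m1 m3 h')
    · exact Or.inr ⟨by rw [h'], rfl⟩
  · left
    rw [min_lt_iff, h.strictMonoOn.lt_iff_lt m2 m3]
    right
    nlinarith

lemma dominance (h : IsGeneralizedCPFRepresentation ρ G d) : Dominance ρ := by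
  intro x y hxy hdom w z hwz
  have hd := h.discount
  rw [temporallyDominates_iff] at hdom
  have hR : cpfRatio d (x - y) = 1 := by
    rw [cpfRatio, div_eq_one_iff_eq (cpfNorm_pos hd (sub_ne_zero.2 hxy)).ne', cpfNorm,
      absStream_eq_self hdom]
  have m := cpfRatio_mem hd (w - z)
  rw [h.eq_ratio hxy, h.eq_ratio hwz, hR]
  refine ⟨h.strictMonoOn.monotoneOn m (by norm_num) m.2, fun hnd => ?_⟩
  rw [temporallyDominates_iff] at hnd
  push Not at hnd
  obtain ⟨t, ht⟩ := hnd
  refine h.strictMonoOn m (by norm_num) ?_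
  rw [cpfRatio, div_lt_one (cpfNorm_pos hd (sub_ne_zero.2 hwz))]
  exact discountedLin_lt_cpfNorm hd ht

lemma sum_abs_eq_of_subsingleton {κ : Type*} (s : Finset κ) (g : κ → ℝ)
    (h : {i | i ∈ s ∧ g i ≠ 0}.Subsingleton) : ∑ i ∈ s, |g i| = |∑ i ∈ s, g i| := by
  by_cases hex : ∃ i ∈ s, g i ≠ 0
  · obtain ⟨i, hi, hne⟩ := hex
    have hz : ∀ j ∈ s, j ≠ i → g j = 0 := by
      intro j hj hji
      by_contra hgj
      exact hji (h ⟨hj, hgj⟩ ⟨hi, hne⟩)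
    rw [Finset.sum_eq_single_of_mem i hi hz,
      Finset.sum_eq_single_of_mem i hi fun j hj hji => by rw [hz j hj hji, abs_zero]]
  · push Not at hex
    rw [Finset.sum_eq_zero hex, Finset.sum_eq_zero fun i hi => by rw [hex i hi, abs_zero],
      abs_zero]

/-- Cancelling the payoff gap at `t₀` at the cost of changing it at one other date of the grid
lowers the CPF norm if it leaves discounted utility unchanged. -/
lemma cpfNorm_le_of_transfer (hd : IsDiscountFunction d) {T : Finset ℝ≥0} {v v' : PayoffStream}
    (hv : v.support ⊆ T) (hv' : v'.support ⊆ T) {t₀ : ℝ≥0} (h₀ : t₀ ∈ T)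
    (hz : cumulativeLin t₀ v' = 0)
    (hs : {t | t ∈ T \ {t₀} ∧ cumulativeLin t v' ≠ cumulativeLin t v}.Subsingleton)
    (hD : discountedLin d v' = discountedLin d v) : cpfNorm d v' ≤ cpfNorm d v := by
  obtain ⟨n, hn⟩ := exists_isSuccessor T
  set g : ℝ≥0 → ℝ := fun t => d t - d (n t) with hg
  have hg0 : ∀ t ∈ T, 0 < g t := fun t ht => sub_pos.2 (hd.strictAnti (hn.lt t ht))
  have hN : ∀ u : PayoffStream, u.support ⊆ T →
      cpfNorm d u = ∑ t ∈ T, |cumulativeLin t u * g t| := by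
    intro u hu
    rw [cpfNorm, ← stepStream_abs hn hu, discountedLin_stepStream hd.top_eq_zero]
    exact Finset.sum_congr rfl fun t ht => by rw [abs_mul, abs_of_pos (hg0 t ht)]
  have hDs : ∀ u : PayoffStream, u.support ⊆ T →
      discountedLin d u = ∑ t ∈ T, cumulativeLin t u * g t := by
    intro u hu
    conv_lhs => rw [← stepStream_cumulativeLin hn hu, discountedLin_stepStream hd.top_eq_zero]
  rw [hDs v hv, hDs v' hv', Finset.sum_eq_add_sum_sdiff_singleton_of_mem h₀,
    Finset.sum_eq_add_sum_sdiff_singleton_of_mem h₀ (fun t => cumulativeLin t v * g t), hz, zero_mul,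
    zero_add] at hD
  rw [hN v hv, hN v' hv', Finset.sum_eq_add_sum_sdiff_singleton_of_mem h₀,
    Finset.sum_eq_add_sum_sdiff_singleton_of_mem h₀ (fun t => |cumulativeLin t v * g t|), hz,
    zero_mul, abs_zero, zero_add]
  -- As DU is unchanged, the changes at dates other than `t₀` add up to the coordinate lost at `t₀`.
  -- They occur at a single date, so their absolute values add up to its absolute value, and the
  -- triangle inequality finishes.
  have h1 := sum_abs_eq_of_subsingleton (T \ {t₀})
    (fun t => cumulativeLin t v' * g t - cumulativeLin t v * g t) (hs.anti fun t ht =>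
      ⟨ht.1, fun h' => ht.2 (by rw [h', sub_self])⟩)
  rw [Finset.sum_sub_distrib, hD, add_sub_cancel_right] at h1
  rw [← h1, ← Finset.sum_add_distrib]
  refine Finset.sum_le_sum fun t _ => ?_
  have := abs_add_le (cumulativeLin t v' * g t - cumulativeLin t v * g t) (cumulativeLin t v * g t)
  rwa [sub_add_cancel] at this

lemma simplification (h : IsGeneralizedCPFRepresentation ρ G d) (hρ : IsBinaryChoiceRule ρ) :
    Simplification ρ := by
  rintro x y hxy hle x' hsupp ⟨t₀, h₀, hM, hs⟩ hx'x hhalf hx'y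
  have hd := h.discount
  rw [h.half_le_iff hρ hxy] at hle
  rw [h.eq_half_iff hρ hx'x] at hhalf
  have hD : discountedLin d (x' - y) = discountedLin d (x - y) := by
    rw [map_sub] at hhalf ⊢
    rw [map_sub]; linarith
  rw [cumulativePayoff_coe, cumulativePayoff_coe] at hM
  have hN : cpfNorm d (x' - y) ≤ cpfNorm d (x - y) := by
    refine cpfNorm_le_of_transfer hd (T := x.support ∪ y.support) Finsupp.support_sub
      (Finsupp.support_sub.trans (Finset.union_subset hsupp Finset.subset_union_right)) h₀
      (by rw [map_sub, hM, sub_self]) (hs.anti fun t ht => ⟨ht.1, ?_⟩) hD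
    have h2 := ht.2
    rw [map_sub, map_sub, Ne, sub_left_inj] at h2
    rwa [cumulativePayoff_coe, cumulativePayoff_coe]
  rw [h.eq_ratio hxy, h.eq_ratio hx'y]
  refine h.strictMonoOn.monotoneOn (cpfRatio_mem hd _) (cpfRatio_mem hd _) ?_
  rw [cpfRatio, cpfRatio, hD]
  exact div_le_div_of_nonneg_left hle (cpfNorm_pos hd (sub_ne_zero.2 hx'y)) hN

theorem satisfiesT1toT5 [TopologicalSpace PayoffStream]
    (hτ : IsAdmissibleTopology ‹TopologicalSpace PayoffStream›)
    (h : IsGeneralizedCPFRepresentation ρ G d) (hρ : IsBinaryChoiceRule ρ) :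
    SatisfiesT1toT5 ρ :=
  ⟨h.continuity hτ, h.linearity, h.moderateTransitivity hρ, h.dominance, h.simplification hρ⟩

/-! ### Uniqueness -/

theorem discount_unique (h : IsGeneralizedCPFRepresentation ρ G d) (hρ : IsBinaryChoiceRule ρ)
    {G' : ℝ → ℝ} {d' : ℝ≥0∞ → ℝ} (h' : IsGeneralizedCPFRepresentation ρ G' d') :
    ∃ C : ℝ, 0 < C ∧ ∀ t, d' t = C * d t := by
  have hd := h.discount
  have hd' := h'.discount
  have hd0 : 0 < d 0 := by simpa using hd.coe_pos 0
  have hd0' : 0 < d' 0 := by simpa using hd'.coe_pos 0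
  refine ⟨d' 0 / d 0, div_pos hd0' hd0, fun t => ?_⟩
  by_cases ht : t = 0
  · rw [ht, div_mul_cancel₀ _ hd0.ne']
  -- DU vanishes on this stream, so it is indifferent to 0, and therefore discounted utility under
  -- d' vanishes on it too.
  set v := d 0 • unitAt t - d t • unitAt 0 with hv
  have hD : ∀ {e : ℝ≥0∞ → ℝ}, IsDiscountFunction e → discountedLin e v = d 0 * e t - d t * e 0 := by
    intro e he
    simp [hv, discountedLin_unitAt he.top_eq_zero]
  -- This occurs at t = ∞, where ρ cannot be evaluated but the identity is trivial.
  by_cases hv0 : v = 0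
  · have := hD hd'
    rw [hv0, map_zero] at this
    field_simp; linarith
  have h1 := hD hd
  rw [mul_comm, sub_self] at h1
  have h2 := (h.eq_half_iff hρ hv0).2 (by rwa [sub_zero])
  rw [h'.eq_half_iff hρ hv0, sub_zero, hD hd'] at h2
  field_simp; linarith

lemma _root_.cpfRatio_const_mul {C : ℝ} (hC : 0 < C) {d d' : ℝ≥0∞ → ℝ} (h : ∀ t, d' t = C * d t)
    (v : PayoffStream) : cpfRatio d' v = cpfRatio d v := by
  have : discountedLin d' = C • discountedLin d := by
    refine Finsupp.lhom_ext fun t a => ?_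
    simp [discountedLin, h]; ring
  rw [cpfRatio, cpfRatio, cpfNorm, cpfNorm, this]
  simp only [LinearMap.smul_apply, smul_eq_mul]
  exact mul_div_mul_left _ _ hC.ne'

theorem eqOn (h : IsGeneralizedCPFRepresentation ρ G d) (hρ : IsBinaryChoiceRule ρ)
    {G' : ℝ → ℝ} {d' : ℝ≥0∞ → ℝ} (h' : IsGeneralizedCPFRepresentation ρ G' d') :
    Set.EqOn G' G (Set.Icc (-1) 1) := by
  obtain ⟨C, hC, hCd⟩ := h.discount_unique hρ h'
  obtain ⟨u, w, huw⟩ := exists_ratio_line h.discount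
  intro r hr
  obtain ⟨h0, h1⟩ := huw r hr
  have e1 := h.eq_ratio h0
  have e2 := h'.eq_ratio h0
  rw [sub_zero, h1] at e1
  rw [sub_zero, cpfRatio_const_mul hC hCd, h1] at e2
  rw [← e1, ← e2]

end IsGeneralizedCPFRepresentation

end Representation

/-! ### From the axioms to the representation -/

section Axioms

variable {ρ : PayoffStream → PayoffStream → ℝ}

/-- Mixing (x, y) equally with -y and (x - y, 0) equally with 0 gives the same pair. -/
lemma Linearity.eq_sub (hL : Linearity ρ) {x y : PayoffStream} (hxy : x ≠ y) :
    ρ x y = ρ (x - y) 0 := by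
  have h1 := hL x y (-y) hxy (1 / 2) (by norm_num)
  have h2 := hL (x - y) 0 0 (sub_ne_zero.2 hxy) (1 / 2) (by norm_num)
  rw [h1, h2]
  congr 1 <;> module

lemma Linearity.smul (hL : Linearity ρ) {v : PayoffStream} (hv : v ≠ 0) {c : ℝ} (hc : 0 < c) :
    ρ (c • v) 0 = ρ v 0 := by
  have key : ∀ {v : PayoffStream}, v ≠ 0 → ∀ {c : ℝ}, 0 < c → c < 1 → ρ (c • v) 0 = ρ v 0 := by
    intro v hv c hc hc1
    have := hL v 0 0 hv c ⟨hc, hc1⟩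
    simpa using this.symm
  rcases lt_trichotomy c 1 with h | rfl | h
  · exact key hv hc h
  · rw [one_smul]
  · have := key (smul_ne_zero hc.ne' hv) (inv_pos.2 hc) (inv_lt_one_of_one_lt₀ h)
    rw [inv_smul_smul₀ hc.ne'] at this
    exact this.symm

lemma Linearity.neg (hL : Linearity ρ) (hρ : IsBinaryChoiceRule ρ) {v : PayoffStream}
    (hv : v ≠ 0) : ρ (-v) 0 = 1 - ρ v 0 := by
  rw [(hρ v 0 hv).2, hL.eq_sub hv.symm, zero_sub]; ring

/-! ### Indifference to the zero stream, the revealed discount function, and the construction of G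
-/

namespace SatisfiesT1toT5

variable [TopologicalSpace PayoffStream]

/-- T3 along u + v, v, 0, in additive form. -/
lemma add (h : SatisfiesT1toT5 ρ) {u v : PayoffStream} (hu : u ≠ 0) (hv : v ≠ 0) (huv : u + v ≠ 0)
    (h1 : 1 / 2 ≤ ρ u 0) (h2 : 1 / 2 ≤ ρ v 0) :
    min (ρ u 0) (ρ v 0) < ρ (u + v) 0 ∨ (ρ (u + v) 0 = ρ u 0 ∧ ρ u 0 = ρ v 0) := by
  have hne : u + v ≠ v := by simpa using hu
  have e : ρ (u + v) v = ρ u 0 := by rw [h.linearity.eq_sub hne, add_sub_cancel_right]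
  have := h.moderateTransitivity (u + v) v 0 hne hv huv (by rwa [e]) h2
  rwa [e] at this

lemma half_le_add (h : SatisfiesT1toT5 ρ) {u v : PayoffStream} (hu : u ≠ 0) (hv : v ≠ 0)
    (huv : u + v ≠ 0) (h1 : 1 / 2 ≤ ρ u 0) (h2 : 1 / 2 ≤ ρ v 0) : 1 / 2 ≤ ρ (u + v) 0 := by
  rcases h.add hu hv huv h1 h2 with h3 | h3
  · exact (le_min h1 h2).trans h3.le
  · rw [h3.1]; exact h1

lemma dominance_sub (h : SatisfiesT1toT5 ρ) {v w : PayoffStream} (hv : v ≠ 0) (hw : w ≠ 0)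
    (hd : ∀ t, 0 ≤ cumulativeLin t v) {t : ℝ≥0} (ht : cumulativeLin t w < 0) :
    ρ w 0 < ρ v 0 := by
  refine (h.dominance v 0 hv ?_ w 0 hw).2 fun hdom => ?_
  · rw [temporallyDominates_iff]; simpa using hd
  · rw [temporallyDominates_iff] at hdom
    have := hdom t
    rw [sub_zero] at this
    linarith

lemma half_lt_of_nonneg (h : SatisfiesT1toT5 ρ) (hρ : IsBinaryChoiceRule ρ) {v : PayoffStream}
    (hv : v ≠ 0) (hd : ∀ t, 0 ≤ cumulativeLin t v) : 1 / 2 < ρ v 0 := by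
  obtain ⟨t, ht⟩ : ∃ t, cumulativeLin t v ≠ 0 := by
    by_contra! h0
    exact hv (eq_zero_of_cumulativeLin v fun t _ => h0 t)
  have := h.dominance_sub hv (neg_ne_zero.2 hv) hd (t := t)
    (by rw [map_neg]; exact neg_neg_of_pos ((hd t).lt_of_ne' ht))
  rw [h.linearity.neg hρ hv] at this
  linarith

/-- The streams that are indifferent to the zero stream. -/
def indifferent (h : SatisfiesT1toT5 ρ) (hρ : IsBinaryChoiceRule ρ) :
    Submodule ℝ PayoffStream where
  carrier := {v | v ≠ 0 → ρ v 0 = 1 / 2}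
  zero_mem' h0 := absurd rfl h0
  add_mem' := by
    intro u v hu hv huv
    by_cases hu0 : u = 0
    · subst hu0; rw [zero_add] at huv ⊢; exact hv huv
    by_cases hv0 : v = 0
    · subst hv0; rw [add_zero] at huv ⊢; exact hu huv
    have h1 := h.half_le_add hu0 hv0 huv (hu hu0).ge (hv hv0).ge
    -- T3 gives only the inequality ≥ 1/2; applied to -u and -v it gives the opposite one.
    have e : -u + -v = -(u + v) := by abel
    have h2 := h.half_le_add (neg_ne_zero.2 hu0) (neg_ne_zero.2 hv0)
      (by rw [e]; exact neg_ne_zero.2 huv)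
      (by rw [h.linearity.neg hρ hu0, hu hu0]; norm_num)
      (by rw [h.linearity.neg hρ hv0, hv hv0]; norm_num)
    rw [e, h.linearity.neg hρ huv] at h2
    linarith
  smul_mem' := by
    intro c v hv hcv
    have hc : c ≠ 0 := fun h0 => hcv (by rw [h0, zero_smul])
    have hv0 : v ≠ 0 := fun h0 => hcv (by rw [h0, smul_zero])
    rcases lt_or_gt_of_ne hc with hc | hc
    · have : c • v = -((-c) • v) := by module
      rw [this, h.linearity.neg hρ (smul_ne_zero (by linarith) hv0),
        h.linearity.smul hv0 (by linarith), hv hv0]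
      norm_num
    · rw [h.linearity.smul hv0 hc, hv hv0]

/-- The line stays in the streams paying at a fixed finite set of dates, which depend continuously
on the amounts. -/
lemma continuous_line (hτ : IsAdmissibleTopology ‹TopologicalSpace PayoffStream›)
    (u w : PayoffStream) : Continuous fun r : ℝ => u + r • w := by
  classical
  have h1 : Continuous fun r : ℝ =>
      fun t : (u.support ∪ w.support : Finset ℝ≥0) => u t + r * w t :=
    continuous_pi fun t => by fun_prop
  convert (hτ.continuous_amounts (u.support ∪ w.support)).comp h1 using 1
  funext r
  have hs : (u + r • w).support ⊆ u.support ∪ w.support :=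
    Finsupp.support_add.trans (Finset.union_subset_union_right Finsupp.support_smul)
  conv_lhs => rw [← Finsupp.sum_single (u + r • w)]
  rw [Finsupp.sum_of_support_subset _ hs _ (by simp), ← Finset.sum_coe_sort]
  rfl

lemma continuousOn_line (hτ : IsAdmissibleTopology ‹TopologicalSpace PayoffStream›)
    (h : SatisfiesT1toT5 ρ) {u w : PayoffStream} {s : Set ℝ} (hs : ∀ r ∈ s, u + r • w ≠ 0) :
    ContinuousOn (fun r : ℝ => ρ (u + r • w) 0) s :=
  h.continuity.comp (f := fun r : ℝ => (u + r • w, (0 : PayoffStream)))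
    ((continuous_line hτ u w).prodMk continuous_const).continuousOn hs

/-- Intermediate values along r ↦ (one unit at t) - (r units at 0): dominance puts ρ above 1/2 at r
= 0 and below it at r = 1. For t > 0 the line avoids the zero stream, where ρ is not controlled. -/
lemma exists_indifferent (hτ : IsAdmissibleTopology ‹TopologicalSpace PayoffStream›)
    (h : SatisfiesT1toT5 ρ) (hρ : IsBinaryChoiceRule ρ) (t : ℝ≥0) :
    ∃ c : ℝ, unitAt t - c • unitAt 0 ∈ h.indifferent hρ := by
  by_cases ht : t = 0
  · subst ht
    exact ⟨1, by simp⟩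
  have hne : ∀ r : ℝ, unitAt t + r • -unitAt 0 ≠ 0 := fun r h0 => by
    have := DFunLike.congr_fun h0 t
    rw [← ENNReal.coe_zero, unitAt_coe, unitAt_coe] at this
    simp [Ne.symm ht] at this
  have hc := h.continuousOn_line hτ (s := Set.Icc 0 1) (fun r _ => hne r)
  have h0 : 1 / 2 ≤ ρ (unitAt t + (0 : ℝ) • -unitAt 0) 0 := by
    refine (h.half_lt_of_nonneg hρ (hne 0) fun s => ?_).le
    simp only [zero_smul, add_zero, cumulativeLin_unitAt]
    split_ifs <;> norm_num
  have h1 : ρ (unitAt t + (1 : ℝ) • -unitAt 0) 0 ≤ 1 / 2 := by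
    have h2 := h.half_lt_of_nonneg hρ (neg_ne_zero.2 (hne 1)) fun s => by
      simp only [one_smul, map_neg, map_add, cumulativeLin_unitAt]
      rw [if_pos zero_le]
      split_ifs <;> norm_num
    rw [h.linearity.neg hρ (hne 1)] at h2
    linarith
  obtain ⟨c, -, hc⟩ := intermediate_value_Icc' zero_le_one hc ⟨h1, h0⟩
  refine ⟨c, fun _ => ?_⟩
  rw [← hc]
  simp [sub_eq_add_neg]

/-- Linear extension from unit payments: every stream is worth DU(v) units at date 0. -/
lemma sub_mem_indifferent (h : SatisfiesT1toT5 ρ) (hρ : IsBinaryChoiceRule ρ) {d : ℝ≥0∞ → ℝ}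
    (hd : ∀ t : ℝ≥0, unitAt t - d t • unitAt 0 ∈ h.indifferent hρ) (v : PayoffStream) :
    v - discountedLin d v • unitAt 0 ∈ h.indifferent hρ := by
  have e : v - discountedLin d v • unitAt 0 =
      ∑ t ∈ v.support, v t • (unitAt t - d t • unitAt 0) := by
    simp only [smul_sub, Finset.sum_sub_distrib, smul_smul, ← Finset.sum_smul]
    congr 1
    · conv_lhs => rw [← Finsupp.sum_single v]
      exact Finset.sum_congr rfl fun t _ => by rw [unitAt_coe, Finsupp.smul_single_one]
  rw [e]
  exact Submodule.sum_mem _ fun t _ => Submodule.smul_mem _ _ (hd t)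

lemma eq_half_of_discountedLin (h : SatisfiesT1toT5 ρ) (hρ : IsBinaryChoiceRule ρ) {d : ℝ≥0∞ → ℝ}
    (hd : ∀ t : ℝ≥0, unitAt t - d t • unitAt 0 ∈ h.indifferent hρ) {v : PayoffStream} (hv : v ≠ 0)
    (h0 : discountedLin d v = 0) : ρ v 0 = 1 / 2 := by
  have := h.sub_mem_indifferent hρ hd v
  rw [h0, zero_smul, sub_zero] at this
  exact this hv

lemma half_lt_of_discountedLin (h : SatisfiesT1toT5 ρ) (hρ : IsBinaryChoiceRule ρ) {d : ℝ≥0∞ → ℝ}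
    (hd : ∀ t : ℝ≥0, unitAt t - d t • unitAt 0 ∈ h.indifferent hρ) {v : PayoffStream}
    (h0 : 0 < discountedLin d v) : 1 / 2 < ρ v 0 := by
  have hv : v ≠ 0 := by rintro rfl; simp at h0
  have hm := h.sub_mem_indifferent hρ hd v
  have he : discountedLin d v • unitAt 0 ≠ 0 := by
    refine smul_ne_zero h0.ne' ?_
    rw [← ENNReal.coe_zero, unitAt_coe]; simp
  have hpos := h.half_lt_of_nonneg hρ he fun t => by
    rw [map_smul, cumulativeLin_unitAt, if_pos zero_le]
    simpa using h0.le
  set u := discountedLin d v • unitAt 0 with hu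
  by_cases hw : v - u = 0
  · rw [sub_eq_zero.1 hw]; exact hpos
  have h1 : 1 / 2 ≤ ρ v 0 := by
    have := h.half_le_add hw he (by rwa [sub_add_cancel]) (hm hw).ge hpos.le
    rwa [sub_add_cancel] at this
  -- If v were indifferent to 0, then so would be u, the difference of v and v - u; but u is a
  -- positive payment at date 0.
  refine h1.lt_of_ne fun h2 => ?_
  have hvm : v ∈ h.indifferent hρ := fun _ => h2.symm
  have := Submodule.sub_mem _ hvm hm
  rw [sub_sub_cancel] at this
  exact hpos.ne' (this he)

lemma half_le_iff_discountedLin (h : SatisfiesT1toT5 ρ) (hρ : IsBinaryChoiceRule ρ)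
    {d : ℝ≥0∞ → ℝ} (hd : ∀ t : ℝ≥0, unitAt t - d t • unitAt 0 ∈ h.indifferent hρ)
    {v : PayoffStream} (hv : v ≠ 0) : 1 / 2 ≤ ρ v 0 ↔ 0 ≤ discountedLin d v := by
  constructor
  · intro h1
    by_contra h2
    have := h.half_lt_of_discountedLin hρ hd (v := -v) (by rw [map_neg]; linarith)
    rw [h.linearity.neg hρ hv] at this
    linarith
  · intro h1
    rcases h1.lt_or_eq with h1 | h1
    · exact (h.half_lt_of_discountedLin hρ hd h1).le
    · exact (h.eq_half_of_discountedLin hρ hd hv h1.symm).ge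

lemma exists_discount (hτ : IsAdmissibleTopology ‹TopologicalSpace PayoffStream›)
    (h : SatisfiesT1toT5 ρ) (hρ : IsBinaryChoiceRule ρ) :
    ∃ d : ℝ≥0∞ → ℝ, IsDiscountFunction d ∧
      ∀ t : ℝ≥0, unitAt t - d t • unitAt 0 ∈ h.indifferent hρ := by
  choose c hc using h.exists_indifferent hτ hρ
  set d : ℝ≥0∞ → ℝ := fun t => if t = ⊤ then 0 else c t.toNNReal with hd
  have htop : d ⊤ = 0 := by simp [hd]
  have hdm : ∀ t : ℝ≥0, unitAt t - d t • unitAt 0 ∈ h.indifferent hρ := fun t => by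
    simpa [hd] using hc t
  refine ⟨d, ⟨fun a b hab => ?_, htop⟩, hdm⟩
  -- Paying earlier dominates paying later. The case b = ∞ is included and gives positivity of d at
  -- finite dates.
  have hne : unitAt a - unitAt b ≠ 0 := by
    have ha : a ≠ ⊤ := hab.ne_top
    lift a to ℝ≥0 using ha
    intro h0
    have h1 := congrArg (cumulativeLin a) h0
    rw [map_sub, map_zero, cumulativeLin_unitAt, cumulativeLin_unitAt, if_pos le_rfl,
      if_neg (not_le.2 hab)] at h1
    norm_num at h1
  have hnn : ∀ t, 0 ≤ cumulativeLin t (unitAt a - unitAt b) := fun t => by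
    rw [map_sub, cumulativeLin_unitAt, cumulativeLin_unitAt]
    by_cases hbt : b ≤ t
    · rw [if_pos hbt, if_pos (hab.le.trans hbt), sub_self]
    · rw [if_neg hbt, sub_zero]; split_ifs <;> norm_num
  have h1 := h.half_lt_of_nonneg hρ hne hnn
  by_contra hle
  have h2 : 0 ≤ discountedLin d (-(unitAt a - unitAt b)) := by
    rw [map_neg, map_sub, discountedLin_unitAt htop, discountedLin_unitAt htop]
    linarith [not_lt.1 hle]
  rw [← h.half_le_iff_discountedLin hρ hdm (neg_ne_zero.2 hne), h.linearity.neg hρ hne] at h2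
  linarith

lemma isTransferMonotone (h : SatisfiesT1toT5 ρ) (hρ : IsBinaryChoiceRule ρ) {d : ℝ≥0∞ → ℝ}
    (hd : IsDiscountFunction d) (hdm : ∀ t : ℝ≥0, unitAt t - d t • unitAt 0 ∈ h.indifferent hρ)
    {T : Finset ℝ≥0} {n : ℝ≥0 → ℝ≥0∞} (hn : IsSuccessor T n) :
    IsTransferMonotone fun a : T → ℝ => ρ (gridStream d T n a) 0 := by
  have hne : ∀ {a : T → ℝ}, a ≠ 0 → gridStream d T n a ≠ 0 :=
    fun ha => (gridStream_eq_zero hd hn).not.2 ha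
  have hhalf : ∀ {a : T → ℝ}, a ≠ 0 → 0 ≤ ∑ t, a t → 1 / 2 ≤ ρ (gridStream d T n a) 0 := by
    intro a ha hs
    rwa [h.half_le_iff_discountedLin hρ hdm (hne ha), discountedLin_gridStream hd hn]
  refine ⟨fun a c ha hc => ?_, fun u v hu hv huv hsu hsv => ?_, fun a hs i j hij hi hb => ?_,
    fun a e ha he he0 ha0 => ?_⟩
  · simp only [map_smul]
    exact h.linearity.smul (hne ha) hc
  · have h1 := hne huv
    simp only [map_add] at h1 ⊢
    exact h.add (hne hu) (hne hv) h1 (hhalf hu hsu) (hhalf hv hsv)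
  · classical
    have ha : a ≠ 0 := by rintro rfl; exact hi rfl
    -- Only dates in the joint support are allowed in T5. Adding to both options a stream that pays
    -- at every date of T makes the joint support all of T without changing the difference.
    set z : PayoffStream := ∑ t ∈ T, Finsupp.single t 1 with hz
    have hzs : z.support = T := by
      ext t
      simp [hz, Finsupp.finsetSum_apply, Finsupp.single_apply]
    set v := gridStream d T n a with hv
    set v' := gridStream d T n (transfer a i j) with hv'
    have hsv : v.support ⊆ T := support_gridStream hn a
    have hsv' : v'.support ⊆ T := support_gridStream hn _
    have hU : (v + z).support ∪ z.support = T := by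
      rw [hzs]
      exact Finset.union_eq_right.2
        (Finsupp.support_add.trans (Finset.union_subset hsv hzs.subset))
    have hvz : v + z ≠ z := by simpa using hne ha
    have hvz' : v' + z ≠ z := by simpa using hne hb
    have hvv : v' - v ≠ 0 := by
      rw [hv, hv', ← map_sub]
      refine hne fun h0 => hi ?_
      have := congrFun h0 i
      rw [Pi.sub_apply, transfer_src a hij, Pi.zero_apply] at this
      linarith
    have hne' : v' + z ≠ v + z := fun h0 => hvv (by rw [add_right_cancel h0, sub_self])
    have key := h.simplification (v + z) z hvz
      (by rw [h.linearity.eq_sub hvz, add_sub_cancel_right]; exact hhalf ha hs) (v' + z)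
      (by rw [hU]; exact Finsupp.support_add.trans (Finset.union_subset hsv' hzs.subset))
      ⟨i, by rw [hU]; exact i.2, by
        rw [cumulativePayoff_coe, cumulativePayoff_coe, map_add, cumulativeLin_gridStream hn,
          transfer_src a hij, zero_div, zero_add], by
        rw [hU]
        have : ∀ t, t ∈ T \ {(i : ℝ≥0)} ∧
            cumulativePayoff (v' + z) t ≠ cumulativePayoff (v + z) t → t = j := by
          rintro t ⟨ht, hc⟩
          rw [Finset.mem_sdiff, Finset.mem_singleton] at ht
          by_contra htj
          apply hc
          rw [cumulativePayoff_coe, cumulativePayoff_coe, map_add, map_add,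
            cumulativeLin_gridStream hn _ ⟨t, ht.1⟩, cumulativeLin_gridStream hn _ ⟨t, ht.1⟩,
            transfer_of_ne]
          · exact fun h' => ht.2 (congrArg Subtype.val h')
          · exact fun h' => htj (congrArg Subtype.val h')
        exact fun s hs t ht => (this s hs).trans (this t ht).symm⟩
      hne'
      (by
        rw [h.linearity.eq_sub hne', add_sub_add_right_eq_sub]
        refine h.eq_half_of_discountedLin hρ hdm hvv ?_
        rw [map_sub, discountedLin_gridStream hd hn, discountedLin_gridStream hd hn, sum_transfer,
          sub_self])
      hvz'
    rwa [h.linearity.eq_sub hvz, h.linearity.eq_sub hvz', add_sub_cancel_right,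
      add_sub_cancel_right] at key
  · rw [Pi.le_def] at ha0
    push Not at ha0
    obtain ⟨i, hi⟩ := ha0
    refine h.dominance_sub (hne he) (hne ha) (fun t => ?_) (t := i) ?_
    · have e1 : (fun t => |e t|) = e := funext fun t => abs_of_nonneg (he0 t)
      have e2 := absStream_gridStream hd hn e
      rw [e1] at e2
      rw [← e2, cumulativeLin_absStream]
      exact abs_nonneg _
    · rw [cumulativeLin_gridStream hn]
      exact div_neg_of_neg_of_pos hi (gap_pos hd hn i)

/-- Choice probabilities are a strictly increasing function of the ratio. -/
lemma ratio_strictMono (h : SatisfiesT1toT5 ρ) (hρ : IsBinaryChoiceRule ρ) {d : ℝ≥0∞ → ℝ}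
    (hd : IsDiscountFunction d) (hdm : ∀ t : ℝ≥0, unitAt t - d t • unitAt 0 ∈ h.indifferent hρ)
    {v w : PayoffStream} (hv : v ≠ 0) (hw : w ≠ 0) :
    (cpfRatio d v = cpfRatio d w → ρ v 0 = ρ w 0) ∧
      (cpfRatio d v < cpfRatio d w → ρ v 0 < ρ w 0) := by
  classical
  have key : ∀ {v w : PayoffStream}, v ≠ 0 → w ≠ 0 → 0 ≤ discountedLin d v →
      (cpfRatio d v = cpfRatio d w → ρ v 0 = ρ w 0) ∧
      (cpfRatio d v < cpfRatio d w → ρ v 0 < ρ w 0) := by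
    intro v w hv hw h0
    -- The dates 0, 1, 2 ensure that the common grid has at least three points.
    obtain ⟨T, hvT, hwT, hT⟩ : ∃ T : Finset ℝ≥0, v.support ⊆ T ∧ w.support ⊆ T ∧ {0, 1, 2} ⊆ T :=
      ⟨v.support ∪ w.support ∪ {0, 1, 2}, Finset.subset_union_left.trans Finset.subset_union_left,
        Finset.subset_union_right.trans Finset.subset_union_left, Finset.subset_union_right⟩
    obtain ⟨n, hn⟩ := exists_isSuccessor T
    have hcard : 2 < Fintype.card T := by
      rw [Fintype.card_coe]
      have h3 : ({0, 1, 2} : Finset ℝ≥0).card = 3 := by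
        rw [Finset.card_eq_three]
        exact ⟨0, 1, 2, by norm_num, by norm_num, by norm_num, rfl⟩
      exact h3.symm.le.trans (Finset.card_le_card hT)
    obtain ⟨a, rfl⟩ := exists_gridStream hd hn hvT
    obtain ⟨b, rfl⟩ := exists_gridStream hd hn hwT
    have hf := h.isTransferMonotone hρ hd hdm hn
    have ha := (gridStream_eq_zero hd hn).not.1 hv
    have hb := (gridStream_eq_zero hd hn).not.1 hw
    rw [discountedLin_gridStream hd hn] at h0
    simp only [cpfRatio, discountedLin_gridStream hd hn, cpfNorm_gridStream hd hn]
    exact ⟨hf.eq_of_ratio_eq hcard ha hb h0, hf.lt_of_ratio_lt hcard ha hb h0⟩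
  have hneg : ∀ {v w : PayoffStream}, v ≠ 0 → w ≠ 0 → discountedLin d w ≤ 0 →
      (cpfRatio d v = cpfRatio d w → ρ v 0 = ρ w 0) ∧
      (cpfRatio d v < cpfRatio d w → ρ v 0 < ρ w 0) := by
    intro v w hv hw h0
    have := key (neg_ne_zero.2 hw) (neg_ne_zero.2 hv) (by rw [map_neg]; linarith)
    rw [cpfRatio_neg, cpfRatio_neg, h.linearity.neg hρ hv, h.linearity.neg hρ hw] at this
    exact ⟨fun h1 => by linarith [this.1 (by rw [h1])],
      fun h1 => by linarith [this.2 (neg_lt_neg h1)]⟩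
  rcases le_total 0 (discountedLin d v) with h1 | h1
  · exact key hv hw h1
  rcases le_total (discountedLin d w) 0 with h2 | h2
  · exact hneg hv hw h2
  have e1 : cpfRatio d v ≤ 0 := div_nonpos_of_nonpos_of_nonneg h1 (cpfNorm_pos hd hv).le
  have e2 : 0 ≤ cpfRatio d w := div_nonneg h2 (cpfNorm_pos hd hw).le
  have e3 := (h.half_le_iff_discountedLin hρ hdm hw).2 h2
  have e4 := (h.half_le_iff_discountedLin hρ hdm (neg_ne_zero.2 hv)).2 (by rw [map_neg]; linarith)
  rw [h.linearity.neg hρ hv] at e4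
  constructor
  · intro h3
    refine (key hv hw ?_).1 h3
    rw [← cpfRatio_nonneg_iff hd hv, h3]; exact e2
  · intro h3
    -- Here ρ(v, 0) ≤ 1/2 ≤ ρ(w, 0). Equality would force DU(v) = 0, a case already settled by
    -- `key`.
    refine lt_of_le_of_ne (by linarith) fun h4 => ?_
    have z1 : discountedLin d v = 0 := by
      refine le_antisymm h1 (not_lt.1 fun h5 => ?_)
      have := h.half_lt_of_discountedLin hρ hdm (v := -v) (by rw [map_neg]; linarith)
      rw [h.linearity.neg hρ hv] at this
      linarith
    exact ((key hv hw z1.ge).2 h3).ne h4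

/-- G is ρ(·, 0) along the line of `exists_ratio_line`: it inherits continuity from T1 and strict
monotonicity from `ratio_strictMono`. -/
theorem exists_representation (hτ : IsAdmissibleTopology ‹TopologicalSpace PayoffStream›)
    (h : SatisfiesT1toT5 ρ) (hρ : IsBinaryChoiceRule ρ) :
    ∃ (G : ℝ → ℝ) (d : ℝ≥0∞ → ℝ), IsGeneralizedCPFRepresentation ρ G d := by
  obtain ⟨d, hd, hdm⟩ := h.exists_discount hτ hρ
  obtain ⟨u, w, huw⟩ := exists_ratio_line hd
  refine ⟨fun r => ρ (u + r • w) 0, d, hd, h.continuousOn_line hτ fun r hr => (huw r hr).1,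
    fun r hr s hs hrs => ?_, fun x y hxy => ?_⟩
  · refine (h.ratio_strictMono hρ hd hdm (huw r hr).1 (huw s hs).1).2 ?_
    rwa [(huw r hr).2, (huw s hs).2]
  · have hm := huw _ (cpfRatio_mem hd (x - y))
    rw [ratio_eq_cpfRatio hd, h.linearity.eq_sub hxy]
    exact (h.ratio_strictMono hρ hd hdm (sub_ne_zero.2 hxy) hm.1).1 hm.2.symm

end SatisfiesT1toT5

end Axioms

/-! ### Stationarity and exponential discounting -/

/-- A positive, strictly decreasing, multiplicative function on `[0, ∞)` is an exponential. -/
lemma exists_eq_rpow_of_map_add {f : ℝ≥0 → ℝ} (hpos : ∀ t, 0 < f t) (hanti : StrictAnti f)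
    (hmul : ∀ s t, f (s + t) = f s * f t) :
    ∃ δ ∈ Set.Ioo (0 : ℝ) 1, ∀ t : ℝ≥0, f t = δ ^ (t : ℝ) := by
  set g : ℝ≥0 → ℝ := fun t => -Real.log (f t) with hg
  have hadd : ∀ s t, g (s + t) = g s + g t := fun s t => by
    simp only [hg]
    rw [hmul, Real.log_mul (hpos s).ne' (hpos t).ne']; ring
  have hmono : Monotone g := fun s t hst =>
    neg_le_neg (Real.log_le_log (hpos t) (hanti.antitone hst))
  have hg0 : g 0 = 0 := by
    have := hadd 0 0
    rw [add_zero] at this; linarith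
  have hn : ∀ (m : ℕ) (t : ℝ≥0), g (m * t) = m * g t := by
    intro m t
    induction m with
    | zero => simp [hg0]
    | succ m ih => push_cast; rw [add_mul, one_mul, hadd, ih]; ring
  have hlin : ∀ t, g t = t * g 1 := by
    intro t
    -- Both g(mt) and mt·g(1) lie between ⌊mt⌋·g(1) and (⌊mt⌋ + 1)·g(1), so m|g(t) - t·g(1)| is
    -- bounded in m and the difference vanishes.
    have hb : ∀ m : ℕ, m * |g t - t * g 1| ≤ g 1 := by
      intro m
      have h1 : ((⌊(m : ℝ≥0) * t⌋₊ : ℕ) : ℝ≥0) ≤ m * t := Nat.floor_le zero_le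
      have h2 : (m : ℝ≥0) * t ≤ ((⌊(m : ℝ≥0) * t⌋₊ + 1 : ℕ) : ℝ≥0) := by
        push_cast; exact (Nat.lt_floor_add_one _).le
      have h3 := hmono h1
      have h4 := hmono h2
      rw [← mul_one ((⌊(m : ℝ≥0) * t⌋₊ : ℕ) : ℝ≥0), hn, hn] at h3
      rw [← mul_one ((⌊(m : ℝ≥0) * t⌋₊ + 1 : ℕ) : ℝ≥0), hn, hn] at h4
      have h5 : ((⌊(m : ℝ≥0) * t⌋₊ : ℕ) : ℝ) ≤ m * t := by exact_mod_cast h1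
      have h6 : (m * t : ℝ) ≤ (⌊(m : ℝ≥0) * t⌋₊ : ℕ) + 1 := by exact_mod_cast h2
      have h7 : 0 ≤ g 1 := hg0 ▸ hmono zero_le
      push_cast at h4
      rw [← Nat.abs_cast m, ← abs_mul, abs_le]
      constructor
      · nlinarith [mul_le_mul_of_nonneg_right h6 h7]
      · nlinarith [mul_le_mul_of_nonneg_right h5 h7]
    by_contra hne
    have h0 : 0 < |g t - t * g 1| := abs_pos.2 (sub_ne_zero.2 hne)
    obtain ⟨m, hm⟩ := exists_nat_gt (g 1 / |g t - t * g 1|)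
    rw [div_lt_iff₀ h0] at hm
    exact absurd (hb m) (not_le.2 hm)
  have hf0 : f 0 = 1 := by
    have := hmul 0 0
    rw [add_zero] at this
    exact (mul_eq_left₀ (hpos 0).ne').1 this.symm
  refine ⟨f 1, ⟨hpos 1, hf0 ▸ hanti zero_lt_one⟩, fun t => ?_⟩
  have := hlin t
  rw [Real.rpow_def_of_pos (hpos 1), ← Real.exp_log (hpos t), Real.exp_eq_exp]
  simp only [hg] at this
  linarith

/-- The stream `x` delayed by `k`. -/
def delay (k : ℝ≥0) (x : PayoffStream) : PayoffStream := x.mapDomain (· + k)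

lemma delay_spec (k : ℝ≥0) (x : PayoffStream) :
    (∀ t, k ≤ t → delay k x t = x (t - k)) ∧ ∀ t, t < k → delay k x t = 0 := by
  refine ⟨fun t h => ?_, fun t h => ?_⟩
  · have : delay k x (t - k + k) = x (t - k) :=
      Finsupp.mapDomain_apply (add_left_injective k) x (t - k)
    rw [← this, tsub_add_cancel_of_le h]
  · rw [delay, Finsupp.mapDomain_of_notMem_range]
    rintro ⟨s, rfl⟩
    exact not_le.2 h le_add_self

lemma eq_delay {k : ℝ≥0} {x x' : PayoffStream} (h1 : ∀ t, k ≤ t → x' t = x (t - k))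
    (h2 : ∀ t, t < k → x' t = 0) : x' = delay k x := by
  ext t
  rcases le_or_gt k t with h | h
  · rw [h1 t h, (delay_spec k x).1 t h]
  · rw [h2 t h, (delay_spec k x).2 t h]

lemma discountedLin_delay (d : ℝ≥0∞ → ℝ) (k : ℝ≥0) (x : PayoffStream) :
    discountedLin d (delay k x) =
      Finsupp.linearCombination ℝ (fun t : ℝ≥0 => d ((t + k : ℝ≥0) : ℝ≥0∞)) x :=
  Finsupp.linearCombination_mapDomain _ _ _

namespace IsGeneralizedCPFRepresentation

variable {ρ : PayoffStream → PayoffStream → ℝ} {G : ℝ → ℝ} {d : ℝ≥0∞ → ℝ}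

lemma stationarity (h : IsGeneralizedCPFRepresentation ρ G d) (hρ : IsBinaryChoiceRule ρ) {δ : ℝ}
    (hδ : δ ∈ Set.Ioo (0 : ℝ) 1) (hd : ∀ t : ℝ≥0, d t = d 0 * δ ^ (t : ℝ)) : Stationarity ρ := by
  intro x y hxy hlt x' y' k _ h1 h2
  rw [h.half_lt_iff hρ hxy] at hlt
  have hD : ∀ z, discountedLin d (delay k z) = δ ^ (k : ℝ) * discountedLin d z := by
    intro z
    rw [discountedLin_delay, discountedLin, Finsupp.linearCombination_apply,
      Finsupp.linearCombination_apply, Finsupp.mul_sum]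
    refine Finsupp.sum_congr fun t _ => ?_
    rw [hd, hd t, NNReal.coe_add, Real.rpow_add hδ.1, smul_eq_mul, smul_eq_mul]
    ring
  have hx' := eq_delay (fun t ht => (h1 t ht).1) fun t ht => (h2 t ht).1
  have hy' := eq_delay (fun t ht => (h1 t ht).2) fun t ht => (h2 t ht).2
  have hpos : 0 < discountedLin d (x' - y') := by
    rw [map_sub, hx', hy', hD, hD, ← mul_sub, ← map_sub]
    exact mul_pos (Real.rpow_pos_of_pos hδ.1 _) hlt
  have hne : x' ≠ y' := fun h0 => by
    rw [h0, sub_self, map_zero] at hpos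
    exact lt_irrefl _ hpos
  exact (h.half_le_iff hρ hne).2 hpos.le

/-- Compare d(t) at date s with d(s) at date t, which have equal DU. Stationarity needs a strict
preference, so the first amount is raised by ε, and ε tends to 0 after the delay. Exchanging s and t
turns the inequality into an equality. -/
lemma delay_ratio_le (h : IsGeneralizedCPFRepresentation ρ G d) (hρ : IsBinaryChoiceRule ρ)
    (hS : Stationarity ρ) {k : ℝ≥0} (hk : 0 < k) (s t : ℝ≥0) :
    d s * d (t + k : ℝ≥0) ≤ d t * d (s + k : ℝ≥0) := by
  have hd := h.discount
  have key : ∀ ε : ℝ, 0 < ε → d s * d (t + k : ℝ≥0) ≤ (d t + ε) * d (s + k : ℝ≥0) := by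
    intro ε hε
    set x : PayoffStream := Finsupp.single s (d t + ε) with hx
    set y : PayoffStream := Finsupp.single t (d s) with hy
    have hpos : 0 < discountedLin d (x - y) := by
      simp only [hx, hy, discountedLin, map_sub, Finsupp.linearCombination_single, smul_eq_mul]
      nlinarith [mul_pos hε (hd.coe_pos s)]
    have hne : x ≠ y := fun h0 => by
      rw [h0, sub_self, map_zero] at hpos
      exact lt_irrefl _ hpos
    have hle : 0 ≤ discountedLin d (delay k x - delay k y) := by
      by_cases h0 : delay k x = delay k y
      · rw [h0, sub_self, map_zero]
      · rw [← h.half_le_iff hρ h0]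
        exact hS x y hne ((h.half_lt_iff hρ hne).2 hpos) _ _ k hk
          (fun r hr => ⟨(delay_spec k x).1 r hr, (delay_spec k y).1 r hr⟩)
          fun r hr => ⟨(delay_spec k x).2 r hr, (delay_spec k y).2 r hr⟩
    rw [map_sub, discountedLin_delay, discountedLin_delay, hx, hy,
      Finsupp.linearCombination_single, Finsupp.linearCombination_single, smul_eq_mul,
      smul_eq_mul] at hle
    linarith
  refine le_of_forall_pos_le_add fun ε hε => ?_
  have hp := hd.coe_pos (s + k)
  have := key (ε / d (s + k : ℝ≥0)) (div_pos hε hp)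
  rwa [add_mul, div_mul_cancel₀ _ hp.ne'] at this

lemma exists_exponential (h : IsGeneralizedCPFRepresentation ρ G d) (hρ : IsBinaryChoiceRule ρ)
    (hS : Stationarity ρ) :
    ∃ δ ∈ Set.Ioo (0 : ℝ) 1, ∀ t : ℝ≥0, d t = d 0 * δ ^ (t : ℝ) := by
  have hd := h.discount
  have hd0 : 0 < d 0 := by simpa using hd.coe_pos 0
  obtain ⟨δ, hδ, hf⟩ := exists_eq_rpow_of_map_add (f := fun t : ℝ≥0 => d t / d 0)
    (fun t => div_pos (hd.coe_pos t) hd0)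
    (fun s t hst => div_lt_div_of_pos_right (hd.strictAnti (ENNReal.coe_lt_coe.2 hst)) hd0)
    (fun s t => by
      rcases eq_or_ne t 0 with rfl | ht
      · rw [add_zero, ENNReal.coe_zero, div_self hd0.ne', mul_one]
      · have hk : 0 < t := pos_iff_ne_zero.2 ht
        have h1 := h.delay_ratio_le hρ hS hk 0 s
        have h2 := h.delay_ratio_le hρ hS hk s 0
        rw [zero_add, ENNReal.coe_zero] at h1 h2
        have h3 : d 0 * d (s + t : ℝ≥0) = d s * d t := le_antisymm h1 h2
        field_simp
        linarith)
  refine ⟨δ, hδ, fun t => ?_⟩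
  rw [← hf]
  field_simp

theorem stationarity_iff (h : IsGeneralizedCPFRepresentation ρ G d) (hρ : IsBinaryChoiceRule ρ) :
    Stationarity ρ ↔ ∃ δ ∈ Set.Ioo (0 : ℝ) 1, ∀ t : ℝ≥0, d t = d 0 * δ ^ (t : ℝ) :=
  ⟨h.exists_exponential hρ, fun ⟨_, hδ, hd⟩ => h.stationarity hρ hδ hd⟩

end IsGeneralizedCPFRepresentation

/-- Exponential discounting as a discount function on `[0, ∞]`. -/
def expDiscount (δ : ℝ) (t : ℝ≥0∞) : ℝ := if t = ⊤ then 0 else δ ^ t.toReal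

lemma expDiscount_coe (δ : ℝ) (t : ℝ≥0) : expDiscount δ t = δ ^ (t : ℝ) := by
  simp [expDiscount]

lemma isDiscountFunction_expDiscount {δ : ℝ} (hδ : δ ∈ Set.Ioo (0 : ℝ) 1) :
    IsDiscountFunction (expDiscount δ) where
  top_eq_zero := by simp [expDiscount]
  strictAnti s t hst := by
    lift s to ℝ≥0 using hst.ne_top
    induction t using ENNReal.recTopCoe with
    | top => simpa [expDiscount] using Real.rpow_pos_of_pos hδ.1 _
    | coe t =>
      rw [expDiscount_coe, expDiscount_coe]
      exact Real.rpow_lt_rpow_of_exponent_gt hδ.1 hδ.2 (by exact_mod_cast hst)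

/-! ### The integral form of the CPF distance under exponential discounting -/

section Integral

open MeasureTheory

variable {δ : ℝ}

/-- Both sides are linear in v, and for one unit paid at s the identity is ln(1/δ) ∫_s^∞ δ^t dt =
δ^s. Applied to `absStream (x - y)` it identifies the two CPF distances. -/
lemma integral_cumulativePayoff (hδ : δ ∈ Set.Ioo (0 : ℝ) 1) (v : PayoffStream) :
    IntegrableOn (fun t : ℝ => cumulativeLin t.toNNReal v * δ ^ t) (Set.Ici 0) ∧
      Real.log (1 / δ) * ∫ t in Set.Ici (0 : ℝ), cumulativeLin t.toNNReal v * δ ^ t =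
        discountedLin (expDiscount δ) v := by
  have hlog : Real.log δ < 0 := Real.log_neg hδ.1 hδ.2
  induction v using Finsupp.induction_linear with
  | zero => simp
  | add u v hu hv =>
    have e : (fun t : ℝ => cumulativeLin t.toNNReal (u + v) * δ ^ t) =
        (fun t : ℝ => cumulativeLin t.toNNReal u * δ ^ t) +
          fun t : ℝ => cumulativeLin t.toNNReal v * δ ^ t := by
      funext t
      rw [Pi.add_apply, map_add, add_mul]
    refine ⟨by rw [e]; exact hu.1.add hv.1, ?_⟩
    rw [e, map_add, ← hu.2, ← hv.2, ← mul_add]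
    congr 1
    exact integral_add hu.1 hv.1
  | single s a =>
    have e : Set.EqOn (fun t : ℝ => cumulativeLin t.toNNReal (Finsupp.single s a) * δ ^ t)
        ((Set.Ici (s : ℝ)).indicator fun t => a * Real.exp (Real.log δ * t)) (Set.Ici 0) := by
      intro t ht
      have hst : s ≤ t.toNNReal ↔ (s : ℝ) ≤ t := by
        rw [Real.le_toNNReal_iff_coe_le ht]
      by_cases h : (s : ℝ) ≤ t
      · simp [cumulativeLin, hst, h, Real.rpow_def_of_pos hδ.1]
      · simp [cumulativeLin, hst, h]
    have hint : IntegrableOn (fun t => a * Real.exp (Real.log δ * t)) (Set.Ici (s : ℝ)) := by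
      rw [integrableOn_Ici_iff_integrableOn_Ioi]
      exact (integrableOn_exp_mul_Ioi hlog _).const_mul a
    refine ⟨(hint.integrable_indicator measurableSet_Ici).integrableOn.congr_fun e.symm
      measurableSet_Ici, ?_⟩
    rw [setIntegral_congr_fun measurableSet_Ici e, setIntegral_indicator measurableSet_Ici,
      Set.inter_eq_right.2 (Set.Ici_subset_Ici.2 s.coe_nonneg), integral_Ici_eq_integral_Ioi,
      integral_const_mul, integral_exp_mul_Ioi hlog, discountedLin,
      Finsupp.linearCombination_single, expDiscount_coe, Real.rpow_def_of_pos hδ.1, smul_eq_mul,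
      one_div, Real.log_inv]
    have := hlog.ne
    field_simp

lemma cpfDist_eq (hδ : δ ∈ Set.Ioo (0 : ℝ) 1) (x y : PayoffStream) :
    cpfDist δ x y = generalizedCPFDist (expDiscount δ) x y := by
  rw [generalizedCPFDist_eq (isDiscountFunction_expDiscount hδ).top_eq_zero, cpfNorm,
    ← (integral_cumulativePayoff hδ _).2, cpfDist, integral_Ici_eq_integral_Ioi]
  congr 2
  funext t
  rw [cumulativeLin_absStream, map_sub, ← cumulativePayoff_coe, ← cumulativePayoff_coe]
  rfl

lemma presentValue_eq (x : PayoffStream) :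
    presentValue δ x = discountedUtility (expDiscount δ) x := by
  simp only [presentValue, discountedUtility, expDiscount_coe]

lemma isCPFRepresentation_iff {ρ : PayoffStream → PayoffStream → ℝ} {G : ℝ → ℝ}
    (hδ : δ ∈ Set.Ioo (0 : ℝ) 1) :
    IsCPFRepresentation ρ G δ ↔ IsGeneralizedCPFRepresentation ρ G (expDiscount δ) := by
  constructor
  · intro h
    refine ⟨isDiscountFunction_expDiscount hδ, h.continuousOn, h.strictMonoOn, fun x y hxy => ?_⟩
    rw [← presentValue_eq, ← presentValue_eq, ← cpfDist_eq hδ]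
    exact h.represents x y hxy
  · intro h
    refine ⟨hδ, h.continuousOn, h.strictMonoOn, fun x y hxy => ?_⟩
    rw [presentValue_eq, presentValue_eq, cpfDist_eq hδ]
    exact h.represents x y hxy

end Integral

/-- The factor d(0) cancels in the ratio, so G remains the same. -/
lemma IsGeneralizedCPFRepresentation.isCPFRepresentation {ρ : PayoffStream → PayoffStream → ℝ}
    {G : ℝ → ℝ} {d : ℝ≥0∞ → ℝ} (h : IsGeneralizedCPFRepresentation ρ G d) {δ : ℝ}
    (hδ : δ ∈ Set.Ioo (0 : ℝ) 1) (hd : ∀ t : ℝ≥0, d t = d 0 * δ ^ (t : ℝ)) :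
    IsCPFRepresentation ρ G δ := by
  have hD := isDiscountFunction_expDiscount hδ
  have hd0 : 0 < d 0 := by simpa using h.discount.coe_pos 0
  rw [isCPFRepresentation_iff hδ]
  refine ⟨hD, h.continuousOn, h.strictMonoOn, fun x y hxy => ?_⟩
  rw [ratio_eq_cpfRatio hD, h.eq_ratio hxy]
  congr 1
  refine cpfRatio_const_mul hd0 (fun t => ?_) _
  induction t using ENNReal.recTopCoe with
  | top => rw [h.discount.top_eq_zero, hD.top_eq_zero, mul_zero]
  | coe t => rw [expDiscount_coe, hd]

end

theorem mainTheorem10 [τ : TopologicalSpace PayoffStream] (hτ : IsAdmissibleTopology τ)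
    (ρ : PayoffStream → PayoffStream → ℝ) (hρ : IsBinaryChoiceRule ρ) :
    (SatisfiesT1toT5 ρ ↔
      ∃ (G : ℝ → ℝ) (d : ℝ≥0∞ → ℝ), IsGeneralizedCPFRepresentation ρ G d) ∧
    (∀ (G G' : ℝ → ℝ) (d d' : ℝ≥0∞ → ℝ),
      IsGeneralizedCPFRepresentation ρ G d → IsGeneralizedCPFRepresentation ρ G' d' →
        Set.EqOn G' G (Set.Icc (-1) 1) ∧ ∃ C : ℝ, 0 < C ∧ ∀ t, d' t = C * d t) ∧
    ((SatisfiesT1toT5 ρ ∧ Stationarity ρ) ↔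
      ∃ (G : ℝ → ℝ) (δ : ℝ), IsCPFRepresentation ρ G δ) ∧
    (∀ (G : ℝ → ℝ) (d : ℝ≥0∞ → ℝ), IsGeneralizedCPFRepresentation ρ G d →
      (Stationarity ρ ↔
        ∃ δ ∈ Set.Ioo (0 : ℝ) 1, ∀ t : ℝ≥0, d t = d 0 * δ ^ (t : ℝ))) := by
  refine ⟨⟨fun h => h.exists_representation hτ hρ, fun ⟨_, _, h⟩ => h.satisfiesT1toT5 hτ hρ⟩,
    fun G G' d d' h h' => ⟨h.eqOn hρ h', h.discount_unique hρ h'⟩, ⟨?_, ?_⟩,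
    fun _ _ h => h.stationarity_iff hρ⟩
  · rintro ⟨hT, hS⟩
    obtain ⟨G, d, h⟩ := hT.exists_representation hτ hρ
    obtain ⟨δ, hδ, hd⟩ := h.exists_exponential hρ hS
    exact ⟨G, δ, h.isCPFRepresentation hδ hd⟩
  · rintro ⟨G, δ, h⟩
    have hδ := h.discount_mem
    have h' := (isCPFRepresentation_iff hδ).1 h
    refine ⟨h'.satisfiesT1toT5 hτ hρ, h'.stationarity hρ hδ fun t => ?_⟩
    rw [← ENNReal.coe_zero, expDiscount_coe, expDiscount_coe, NNReal.coe_zero, Real.rpow_zero,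
      one_mul]
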